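/- Let $\mathbb{K}$ be $\mathbb{R}$ or $\mathbb{C}$, and put $\alpha_{\mathbb{K}}=1$ if $\mathbb{K}=\mathbb{R}$ and $\alpha_{\mathbb{K}}=0$ if $\mathbb{K}=\mathbb{C}$. Write ${}^*$ for the adjoint, ${}^+$ for the Moore–Penrose pseudoinverse and $\|\cdot\|_{\rm F}$ for the Frobenius norm. Let $n\ge \ell$, and let $\Omega\in\mathbb{K}^{n\times \ell}$ be a random matrix. Call $\Omega$ a *Gaussian embedding* if its entries are independent $\mathcal{N}_{\mathbb{K}}(0,1)$ random variables, where $\mathcal{N}_{\mathbb{C}}(0,1)$ is the law of $(g_1+\mathrm{i}g_2)/\sqrt2$ for independent $g_1,g_2\sim\mathcal{N}_{\mathbb{R}}(0,1)$. Call $\Omega$ a *random orthonormal embedding* if $U\Omega$ has the same distribution as $\Omega$ for every unitary $U\in\mathbb{K}^{n\times n}$ and $\Omega^*\Omega=\mathbf{I}$ with probability one. **Theorem (Sketch-and-solve: exact analysis).** Let $\Omega\in\mathbb{K}^{n\times\ell}$ be a Gaussian or random orthonormal embedding, and let $A\in\mathbb{K}^{n\times d}$ and $B\in\mathbb{K}^{n\times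 p}$ be fixed matrices with $r:=\operatorname{rank}(A)<\ell-\alpha_{\mathbb{K}}$. Then the sketch-and-solve solution $\hat X=(\Omega^*A)^+(\Omega^*B)$ is integrable and unbiased for either embedding, $$\mathbb{E}[\hat X]=A^+B .$$ Moreover, the squared residual $\|B-A\hat X\|_{\rm F}^2$ is integrable, the minimum of $\|B-AX\|_{\rm F}^2$ over $X\in\mathbb{K}^{d\times p}$ is attained, and $$\mathbb{E}\,\|B-A\hat X\|_{\rm F}^2=\left(1+\frac{r}{\ell-r-\alpha_{\mathbb{K}}}\right)\min_{X\in\mathbb{K}^{d\times p}}\|B-AX\|_{\rm F}^2\qquad\text{if }\Omega\text{ is a Gaussian embedding},$$ $$\mathbb{E}\,\|B-A\hat X\|_{\rm F}^2=\left(1+\frac{n-\ell}{n-r}\,\frac{r}{\ell-r-\alpha_{\mathbb{K}}}\right)\min_{X\in\mathbb{K}^{d\times p}}\|B-AX\|_{\rm F}^2\qquad\text{if }\Omega\text{ is a random orthonormal embedding}.$$ -/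

import Mathlib

open MeasureTheory ProbabilityTheory Matrix
open scoped Matrix

/- All matrix norms below are Frobenius norms. -/
attribute [local instance] Matrix.frobeniusNormedAddCommGroup

namespace SketchSolve

/-! ### The Moore–Penrose pseudoinverse -/

/-- `P` satisfies the four Penrose conditions for `A`. -/
structure IsMoorePenrose {𝕂 : Type*} [RCLike 𝕂] {m n : ℕ}
    (A : Matrix (Fin m) (Fin n) 𝕂) (P : Matrix (Fin n) (Fin m) 𝕂) : Prop where
  mul_mul_self : A * P * A = A
  self_mul_mul : P * A * P = P
  left_isHermitian : (A * P).IsHermitian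
  right_isHermitian : (P * A).IsHermitian

theorem IsMoorePenrose.unique {𝕂 : Type*} [RCLike 𝕂] {m n : ℕ}
    {A : Matrix (Fin m) (Fin n) 𝕂} {P Q : Matrix (Fin n) (Fin m) 𝕂}
    (hP : IsMoorePenrose A P) (hQ : IsMoorePenrose A Q) : P = Q := by
  have h1 : A * P = A * Q := by
    have h := hP.left_isHermitian.eq
    calc A * P = (A * P)ᴴ := h.symm
      _ = ((A * Q) * (A * P))ᴴ := by
        rw [← Matrix.mul_assoc, hQ.mul_mul_self]
      _ = (A * P) * (A * Q) := by
        rw [conjTranspose_mul, h, hQ.left_isHermitian.eq]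
      _ = A * Q := by rw [← Matrix.mul_assoc, hP.mul_mul_self]
  have h2 : P * A = Q * A := by
    have h := hP.right_isHermitian.eq
    calc P * A = (P * A)ᴴ := h.symm
      _ = ((P * A) * (Q * A))ᴴ := by
        rw [Matrix.mul_assoc P, ← Matrix.mul_assoc A, hQ.mul_mul_self]
      _ = (Q * A) * (P * A) := by
        rw [conjTranspose_mul, h, hQ.right_isHermitian.eq]
      _ = Q * A := by rw [Matrix.mul_assoc Q, ← Matrix.mul_assoc A, hP.mul_mul_self]
  calc P = P * A * P := hP.self_mul_mul.symm
    _ = Q * (A * P) := by rw [h2, Matrix.mul_assoc]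
    _ = Q := by rw [h1, ← Matrix.mul_assoc, hQ.self_mul_mul]

theorem exists_isMoorePenrose {𝕂 : Type*} [RCLike 𝕂] {m n : ℕ}
    (A : Matrix (Fin m) (Fin n) 𝕂) : ∃ P, IsMoorePenrose A P := by
  classical
  have hH : (Aᴴ * A).IsHermitian := isHermitian_conjTranspose_mul_self A
  obtain ⟨G, hG, h1, h2, h3⟩ : ∃ G : Matrix (Fin n) (Fin n) 𝕂, G.IsHermitian ∧
      (Aᴴ * A) * G * (Aᴴ * A) = Aᴴ * A ∧ G * (Aᴴ * A) * G = G ∧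
      (G * (Aᴴ * A)).IsHermitian := by
    generalize Aᴴ * A = H at hH ⊢
    set U : Matrix (Fin n) (Fin n) 𝕂 := (hH.eigenvectorUnitary : Matrix (Fin n) (Fin n) 𝕂)
    set v : Fin n → 𝕂 := fun i => (hH.eigenvalues i : 𝕂)
    have hU : Uᴴ * U = 1 := Unitary.coe_star_mul_self hH.eigenvectorUnitary
    have hs : H = U * diagonal v * Uᴴ := by
      have := hH.spectral_theorem
      rw [Unitary.conjStarAlgAut_apply] at this
      exact this
    have key : ∀ a b : Fin n → 𝕂, (U * diagonal a * Uᴴ) * (U * diagonal b * Uᴴ) =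
        U * diagonal (fun i => a i * b i) * Uᴴ := by
      intro a b
      calc (U * diagonal a * Uᴴ) * (U * diagonal b * Uᴴ)
          = U * diagonal a * (Uᴴ * U) * diagonal b * Uᴴ := by simp only [Matrix.mul_assoc]
        _ = _ := by rw [hU, Matrix.mul_one, Matrix.mul_assoc U, diagonal_mul_diagonal]
    have herm : ∀ a : Fin n → ℝ, (U * diagonal (fun i => (a i : 𝕂)) * Uᴴ).IsHermitian := by
      intro a
      have : (diagonal (fun i => (a i : 𝕂))).IsHermitian := by
        rw [Matrix.IsHermitian, diagonal_conjTranspose]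
        congr 1
        ext i
        simp
      exact isHermitian_mul_mul_conjTranspose U this
    have hv : ∀ i, v i = (hH.eigenvalues i : 𝕂) := fun _ => rfl
    clear_value v
    generalize hH.eigenvalues = e at hv
    clear_value U
    subst hs
    refine ⟨U * diagonal (fun i => (((e i)⁻¹ : ℝ) : 𝕂)) * Uᴴ, herm _, ?_, ?_, ?_⟩
    · rw [key, key]
      congr 3
      ext i
      by_cases h : e i = 0 <;> simp [hv, h]
    · rw [key, key]
      congr 3
      ext i
      by_cases h : e i = 0 <;> simp [hv, h]
    · rw [key]
      have := herm (fun i => (e i)⁻¹ * e i)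
      simpa [hv] using this
  refine ⟨G * Aᴴ, ?_, ?_, ?_, ?_⟩
  · have hz : (A * (G * Aᴴ) * A - A)ᴴ * (A * (G * Aᴴ) * A - A) = 0 := by
      have hGH : Gᴴ = G := hG
      simp only [conjTranspose_sub, conjTranspose_mul, conjTranspose_conjTranspose, hGH]
      have e : (Aᴴ * (A * G * Aᴴ) - Aᴴ) * (A * (G * Aᴴ) * A - A) =
          ((Aᴴ * A) * G * (Aᴴ * A)) * G * (Aᴴ * A) - (Aᴴ * A) * G * (Aᴴ * A)
            - (Aᴴ * A) * G * (Aᴴ * A) + Aᴴ * A := by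
        simp only [Matrix.sub_mul, Matrix.mul_sub, Matrix.mul_assoc]
        abel
      rw [e, h1, h1]
      abel
    open scoped ComplexOrder in
    exact sub_eq_zero.mp (conjTranspose_mul_self_eq_zero.mp hz)
  · calc G * Aᴴ * A * (G * Aᴴ) = G * (Aᴴ * A) * G * Aᴴ := by simp only [Matrix.mul_assoc]
      _ = G * Aᴴ := by rw [h2]
  · have := isHermitian_mul_mul_conjTranspose A hG
    simpa only [Matrix.mul_assoc] using this
  · simpa only [Matrix.mul_assoc] using h3

/-- The Moore–Penrose pseudoinverse of `A`: the unique matrix that satisfies the four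
Penrose conditions. -/
noncomputable def pinv {𝕂 : Type*} [RCLike 𝕂] {m n : ℕ} (A : Matrix (Fin m) (Fin n) 𝕂) :
    Matrix (Fin n) (Fin m) 𝕂 :=
  (exists_isMoorePenrose A).choose

theorem isMoorePenrose_pinv {𝕂 : Type*} [RCLike 𝕂] {m n : ℕ}
    (A : Matrix (Fin m) (Fin n) 𝕂) : IsMoorePenrose A (pinv A) :=
  (exists_isMoorePenrose A).choose_spec

/-! ### The field `𝕂` of real or complex numbers

`RCLike.I : 𝕂` is zero exactly when `𝕂` is the field of real numbers. -/

open Classical in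
/-- The constant `α_𝕂`: one over the reals and zero over the complex numbers. -/
noncomputable def alpha (𝕂 : Type*) [RCLike 𝕂] : ℕ :=
  if (RCLike.I : 𝕂) = 0 then 1 else 0

theorem alpha_real : alpha ℝ = 1 := by simp [alpha]

theorem alpha_complex : alpha ℂ = 0 := by simp [alpha]

open Classical in
/-- The standard normal distribution on `𝕂`: over the reals it is `𝒩(0,1)`, and over the complex
numbers it is the law of `(g₁ + i g₂) / √2` for independent `g₁, g₂ ∼ 𝒩(0,1)`. -/
noncomputable def stdNormal (𝕂 : Type*) [RCLike 𝕂] : Measure 𝕂 :=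
  if (RCLike.I : 𝕂) = 0 then
    (gaussianReal 0 1).map (fun g : ℝ => (g : 𝕂))
  else
    ((gaussianReal 0 1).prod (gaussianReal 0 1)).map
      (fun g : ℝ × ℝ => ((g.1 : 𝕂) + RCLike.I * (g.2 : 𝕂)) / ((√2 : ℝ) : 𝕂))

theorem stdNormal_real : stdNormal ℝ = gaussianReal 0 1 := by
  simp [stdNormal]

theorem stdNormal_complex : stdNormal ℂ =
    ((gaussianReal 0 1).prod (gaussianReal 0 1)).map
      (fun g : ℝ × ℝ => ((g.1 : ℂ) + Complex.I * (g.2 : ℂ)) / ((√2 : ℝ) : ℂ)) := by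
  simp [stdNormal]

/-! ### Random matrices -/

/-- The (entrywise) expectation of a random matrix `X` exists and is equal to `M`. -/
def HasExpectation {𝕂 : Type*} [RCLike 𝕂] {S : Type*} [MeasurableSpace S] {m n : ℕ}
    (X : S → Matrix (Fin m) (Fin n) 𝕂) (μ : Measure S) (M : Matrix (Fin m) (Fin n) 𝕂) : Prop :=
  ∀ i j, Integrable (fun ω => X ω i j) μ ∧ ∫ ω, X ω i j ∂μ = M i j

/-- The product (entrywise) σ-algebra on matrices. -/
instance matrixMeasurableSpace {𝕂 : Type*} [RCLike 𝕂] {m n : ℕ} :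
    MeasurableSpace (Matrix (Fin m) (Fin n) 𝕂) :=
  (MeasurableSpace.pi : MeasurableSpace (Fin m → Fin n → 𝕂))

/-- `U Ω` has the same distribution as `Ω` for every (fixed) unitary matrix `U`. -/
def IsRotationInvariant {𝕂 : Type*} [RCLike 𝕂] {S : Type*} [MeasurableSpace S] {n l : ℕ}
    (Ω : S → Matrix (Fin n) (Fin l) 𝕂) (μ : Measure S) : Prop :=
  ∀ U ∈ Matrix.unitaryGroup (Fin n) 𝕂, IdentDistrib (fun ω => U * Ω ω) Ω μ μ

/-- A random orthonormal matrix: rotation-invariant, with `Ω* Ω = I` almost surely. -/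
structure IsRandomOrthonormal {𝕂 : Type*} [RCLike 𝕂] {S : Type*} [MeasurableSpace S] {n l : ℕ}
    (Ω : S → Matrix (Fin n) (Fin l) 𝕂) (μ : Measure S) : Prop where
  rotationInvariant : IsRotationInvariant Ω μ
  orthonormal : ∀ᵐ ω ∂μ, (Ω ω)ᴴ * Ω ω = 1

/-- A Gaussian random matrix: its entries are independent standard normal variables over `𝕂`. -/
structure IsGaussian {𝕂 : Type*} [RCLike 𝕂] {S : Type*} [MeasurableSpace S] {n l : ℕ}
    (Ω : S → Matrix (Fin n) (Fin l) 𝕂) (μ : Measure S) : Prop where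
  law : ∀ i j, HasLaw (fun ω => Ω ω i j) (stdNormal 𝕂) μ
  indep : iIndepFun (fun (ij : Fin n × Fin l) (ω : S) => Ω ω ij.1 ij.2) μ

/-- The sketch-and-solve solution `(Ω* A)⁺ (Ω* B)`. -/
noncomputable def sketchSolve {𝕂 : Type*} [RCLike 𝕂] {n l d p : ℕ}
    (Ω : Matrix (Fin n) (Fin l) 𝕂) (A : Matrix (Fin n) (Fin d) 𝕂)
    (B : Matrix (Fin n) (Fin p) 𝕂) : Matrix (Fin d) (Fin p) 𝕂 :=
  pinv (Ωᴴ * A) * (Ωᴴ * B)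

end SketchSolve

namespace SketchSolve

/-! ### The standard normal distribution on `𝕂` -/

/-! Factor `A = Q T` with `Q` an isometry with `r` columns and `T` of full row rank, and put `C = B
- Q Qᴴ B`, `N = Qᴴ Ω`. When `N` has full row rank, `Ωᴴ A = (Ωᴴ Q) T` is a full-rank factorization,
so the solution is `A⁺ B + T⁺ E` with sketching error `E = (N Nᴴ)⁻¹ N Ωᴴ C`, and the residual is `C
- Q E`. As `Qᴴ C = 0`, its squared norm is `‖C‖² + ‖E‖²`, and `‖C‖²` is the minimum. What remains is
the mean and the second moment of `E`.

The mean vanishes by symmetry: the reflection `2 Q Qᴴ - 1` fixes `Q` and negates `C`, so rotation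
invariance makes `E` and `-E` equidistributed.

Gaussian second moment: let `[Q Q']` be unitary. Then `N` and `W = Q'ᴴ Ω` are independent, `E` is
linear in `W` once `N` is fixed, and the conditional mean of `‖E‖²` is `‖C‖² tr (N Nᴴ)⁻¹`. By a
Schur complement each diagonal entry of `(N Nᴴ)⁻¹` is the inverse squared norm of a Gaussian row of
length `l - r + 1`; its mean `1 / (l - r - α)` comes from a Laplace transform
(`lintegral_gramInvTrace_gaussianMatrix`).

Orthonormal second moment: the mean of `tr (N Nᴴ)⁻¹` follows by comparison with an independent
Gaussian `r × n` matrix `H`. The quantity `‖(H Ω)⁺ H‖²` depends only on the row space of `H`, so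
averaging over `Ω` first gives the wanted mean; averaging over `H` first is a Gaussian computation
(`IsRandomOrthonormal.lintegral_gramInvTrace`). Since `tr (N Nᴴ)⁻¹ = r + ‖E‖²` for `C = Q'`, and the
`n - r` columns of `Q'` contribute equally by invariance, each unit direction orthogonal to `Q`
contributes a known share.

Moments are computed as lower integrals, so finiteness, hence integrability, comes with the value.
-/

theorem re_star_mul {𝕂 : Type*} [RCLike 𝕂] (t z : 𝕂) :
    RCLike.re (star t * z) = RCLike.re t * RCLike.re z + RCLike.im t * RCLike.im z := by
  simp [RCLike.mul_re]

theorem im_I_of_ne_zero {𝕂 : Type*} [RCLike 𝕂] (h : (RCLike.I : 𝕂) ≠ 0) :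
    RCLike.im (RCLike.I : 𝕂) = 1 := by
  have h0 : RCLike.im (RCLike.I : 𝕂) ≠ 0 := by
    intro h1
    apply h
    rw [RCLike.ext_iff]
    simp [h1]
  -- `RCLike.I_im` at `I` makes `im I` idempotent; being nonzero, it is one.
  exact mul_right_cancel₀ h0 (by rw [RCLike.I_im, one_mul])

theorem measurable_stdNormal_embedding {𝕂 : Type*} [RCLike 𝕂] :
    Measurable fun g : ℝ × ℝ => ((g.1 : 𝕂) + RCLike.I * (g.2 : 𝕂)) / ((√2 : ℝ) : 𝕂) := by
  have h1 : Measurable fun g : ℝ × ℝ => ((g.1 : ℝ) : 𝕂) :=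
    RCLike.measurable_ofReal.comp measurable_fst
  have h2 : Measurable fun g : ℝ × ℝ => ((g.2 : ℝ) : 𝕂) :=
    RCLike.measurable_ofReal.comp measurable_snd
  exact (h1.add (h2.const_mul _)).div_const _

instance isProbabilityMeasure_stdNormal {𝕂 : Type*} [RCLike 𝕂] :
    IsProbabilityMeasure (stdNormal 𝕂) := by
  unfold stdNormal
  split_ifs
  · exact Measure.isProbabilityMeasure_map RCLike.measurable_ofReal.aemeasurable
  · exact Measure.isProbabilityMeasure_map measurable_stdNormal_embedding.aemeasurable

theorem re_stdNormal_embedding {𝕂 : Type*} [RCLike 𝕂] (g : ℝ × ℝ) :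
    RCLike.re (((g.1 : 𝕂) + RCLike.I * (g.2 : 𝕂)) / ((√2 : ℝ) : 𝕂)) = g.1 / √2 := by
  rw [RCLike.div_re_ofReal]
  simp

theorem im_stdNormal_embedding {𝕂 : Type*} [RCLike 𝕂] (h : (RCLike.I : 𝕂) ≠ 0) (g : ℝ × ℝ) :
    RCLike.im (((g.1 : 𝕂) + RCLike.I * (g.2 : 𝕂)) / ((√2 : ℝ) : 𝕂)) = g.2 / √2 := by
  rw [div_eq_inv_mul, ← RCLike.ofReal_inv, RCLike.im_ofReal_mul]
  simp [im_I_of_ne_zero h, div_eq_inv_mul]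

theorem integral_exp_gaussianReal (s : ℝ) :
    ∫ x, Complex.exp ((s * x : ℝ) * Complex.I) ∂(gaussianReal 0 1) =
      Complex.exp (((-(s ^ 2 / 2) : ℝ)) : ℂ) := by
  have h := charFun_gaussianReal (μ := 0) (v := 1) s
  rw [charFun_apply_real] at h
  simp only [Complex.ofReal_mul, h]
  congr 1
  push_cast
  ring

/-- The characteristic function of the standard normal distribution. -/
theorem integral_exp_re_stdNormal {𝕂 : Type*} [RCLike 𝕂] (t : 𝕂) :
    ∫ z, Complex.exp ((RCLike.re (star t * z) : ℝ) * Complex.I) ∂(stdNormal 𝕂) =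
      Complex.exp ((-((1 + alpha 𝕂 : ℝ) / 4 * ‖t‖ ^ 2) : ℝ) : ℂ) := by
  have hm : Measurable fun z : 𝕂 =>
      Complex.exp ((RCLike.re (star t * z) : ℝ) * Complex.I) := by
    have : Measurable fun z : 𝕂 => RCLike.re (star t * z) :=
      RCLike.measurable_re.comp (measurable_id.const_mul _)
    fun_prop
  by_cases h : (RCLike.I : 𝕂) = 0
  · simp only [stdNormal, alpha, h, if_true]
    rw [integral_map RCLike.measurable_ofReal.aemeasurable hm.aestronglyMeasurable]
    simp only [re_star_mul, RCLike.ofReal_re, RCLike.ofReal_im, mul_zero, add_zero]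
    rw [integral_exp_gaussianReal, RCLike.norm_sq_eq_def, RCLike.im_eq_zero h]
    congr 2
    push_cast
    ring
  · simp only [stdNormal, alpha, h, if_false]
    rw [integral_map measurable_stdNormal_embedding.aemeasurable hm.aestronglyMeasurable]
    simp only [re_star_mul, re_stdNormal_embedding, im_stdNormal_embedding h]
    have e : ∀ g : ℝ × ℝ, Complex.exp
        (((RCLike.re t * (g.1 / √2) + RCLike.im t * (g.2 / √2) : ℝ) : ℂ) * Complex.I) =
        Complex.exp (((RCLike.re t / √2 * g.1 : ℝ) : ℂ) * Complex.I) *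
          Complex.exp (((RCLike.im t / √2 * g.2 : ℝ) : ℂ) * Complex.I) := by
      intro g
      rw [← Complex.exp_add]
      congr 1
      push_cast
      ring
    simp only [e]
    rw [integral_prod_mul (fun x : ℝ => Complex.exp (((RCLike.re t / √2 * x : ℝ) : ℂ) * Complex.I))
      (fun x : ℝ => Complex.exp (((RCLike.im t / √2 * x : ℝ) : ℂ) * Complex.I)),
      integral_exp_gaussianReal, integral_exp_gaussianReal, ← Complex.exp_add,
      RCLike.norm_sq_eq_def, ← Complex.ofReal_add]
    congr 2
    rw [div_pow, div_pow, Real.sq_sqrt (by norm_num)]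
    push_cast
    ring

theorem integral_exp_neg_sq_gaussianReal {t : ℝ} (ht : 0 ≤ t) :
    ∫ x, Real.exp (-(t * x ^ 2)) ∂(gaussianReal 0 1) = (1 + 2 * t) ^ (-(1 / 2) : ℝ) := by
  rw [integral_gaussianReal_eq_integral_smul one_ne_zero]
  have e : ∀ x : ℝ, gaussianPDFReal 0 1 x • Real.exp (-(t * x ^ 2)) =
      (√(2 * Real.pi))⁻¹ * Real.exp (-(t + 1 / 2) * x ^ 2) := by
    intro x
    simp only [gaussianPDFReal, smul_eq_mul, NNReal.coe_one, mul_one, sub_zero]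
    rw [mul_assoc, ← Real.exp_add]
    congr 2
    ring
  simp only [e]
  rw [integral_const_mul, integral_gaussian, ← Real.sqrt_inv, ← Real.sqrt_mul (by positivity),
    Real.rpow_neg (by positivity), ← Real.sqrt_eq_rpow, ← Real.sqrt_inv]
  congr 1
  have := Real.pi_pos
  field_simp
  ring

/-- The Laplace transform of the squared modulus of a standard normal variable. -/
theorem integral_exp_neg_normSq_stdNormal {𝕂 : Type*} [RCLike 𝕂] {t : ℝ} (ht : 0 ≤ t) :
    ∫ z, Real.exp (-(t * ‖z‖ ^ 2)) ∂(stdNormal 𝕂) =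
      (1 + (1 + alpha 𝕂 : ℝ) * t) ^ (-(1 / (1 + alpha 𝕂 : ℝ))) := by
  have hm : Measurable fun z : 𝕂 => Real.exp (-(t * ‖z‖ ^ 2)) := by fun_prop
  by_cases h : (RCLike.I : 𝕂) = 0
  · simp only [stdNormal, alpha, h, if_true]
    rw [integral_map RCLike.measurable_ofReal.aemeasurable hm.aestronglyMeasurable]
    simp only [RCLike.norm_ofReal, sq_abs]
    rw [integral_exp_neg_sq_gaussianReal ht]
    norm_num
  · simp only [stdNormal, alpha, h, if_false]
    rw [integral_map measurable_stdNormal_embedding.aemeasurable hm.aestronglyMeasurable]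
    simp only [RCLike.norm_sq_eq_def, re_stdNormal_embedding, im_stdNormal_embedding h]
    have e : ∀ g : ℝ × ℝ, Real.exp (-(t * (g.1 / √2 * (g.1 / √2) + g.2 / √2 * (g.2 / √2)))) =
        Real.exp (-(t / 2 * g.1 ^ 2)) * Real.exp (-(t / 2 * g.2 ^ 2)) := by
      intro g
      rw [← Real.exp_add]
      congr 1
      rw [div_mul_div_comm, div_mul_div_comm, Real.mul_self_sqrt (by norm_num)]
      ring
    simp only [e]
    rw [integral_prod_mul (fun x : ℝ => Real.exp (-(t / 2 * x ^ 2)))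
      (fun x : ℝ => Real.exp (-(t / 2 * x ^ 2))),
      integral_exp_neg_sq_gaussianReal (by positivity), ← Real.rpow_add (by positivity),
      mul_div_cancel₀ t two_ne_zero]
    norm_num

theorem lintegral_sq_gaussianReal :
    ∫⁻ x, ENNReal.ofReal (x ^ 2) ∂(gaussianReal 0 1) = 1 := by
  have hL := memLp_id_gaussianReal (μ := 0) (v := 1) 2
  have hi : Integrable (fun x : ℝ => x ^ 2) (gaussianReal 0 1) := hL.integrable_sq
  rw [← ofReal_integral_eq_lintegral_ofReal hi (Filter.Eventually.of_forall fun x => sq_nonneg x)]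
  have h := variance_fun_id_gaussianReal (μ := 0) (v := 1)
  rw [variance_of_integral_eq_zero aemeasurable_id' (by simp)] at h
  simp [h]

/-- A standard normal variable has unit second moment. -/
theorem lintegral_normSq_stdNormal {𝕂 : Type*} [RCLike 𝕂] :
    ∫⁻ z, ENNReal.ofReal (‖z‖ ^ 2) ∂(stdNormal 𝕂) = 1 := by
  have hm : Measurable fun z : 𝕂 => ENNReal.ofReal (‖z‖ ^ 2) := by fun_prop
  by_cases h : (RCLike.I : 𝕂) = 0
  · simp only [stdNormal, h, if_true]
    rw [lintegral_map hm RCLike.measurable_ofReal]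
    simp only [RCLike.norm_ofReal, sq_abs]
    exact lintegral_sq_gaussianReal
  · simp only [stdNormal, h, if_false]
    rw [lintegral_map hm measurable_stdNormal_embedding]
    simp only [RCLike.norm_sq_eq_def, re_stdNormal_embedding, im_stdNormal_embedding h]
    -- The factors `1` put both summands in product form for `lintegral_prod_mul`.
    have e : ∀ g : ℝ × ℝ, ENNReal.ofReal (g.1 / √2 * (g.1 / √2) + g.2 / √2 * (g.2 / √2)) =
        ENNReal.ofReal (1 / 2) * (ENNReal.ofReal (g.1 ^ 2) * 1 + 1 * ENNReal.ofReal (g.2 ^ 2)) := by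
      intro g
      rw [mul_one, one_mul, ← ENNReal.ofReal_add (sq_nonneg _) (sq_nonneg _),
        ← ENNReal.ofReal_mul (by norm_num)]
      congr 1
      rw [div_mul_div_comm, div_mul_div_comm, Real.mul_self_sqrt (by norm_num)]
      ring
    simp only [e]
    rw [lintegral_const_mul _ (by fun_prop), lintegral_add_left (by fun_prop),
      lintegral_prod_mul (f := fun x : ℝ => ENNReal.ofReal (x ^ 2)) (g := fun _ : ℝ => 1)
        (by fun_prop) (by fun_prop),
      lintegral_prod_mul (g := fun x : ℝ => ENNReal.ofReal (x ^ 2)) (f := fun _ : ℝ => 1)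
        (by fun_prop) (by fun_prop), lintegral_sq_gaussianReal]
    simp only [lintegral_const, measure_univ, mul_one]
    rw [one_add_one_eq_two, show (2 : ENNReal) = ENNReal.ofReal 2 by simp,
      ← ENNReal.ofReal_mul (by norm_num)]
    norm_num

/-! ### Frobenius norms, traces and measurability of matrix operations -/

/-- A single sum over index pairs lets exponentials of traces factor over `Measure.pi`. -/
theorem re_trace_conjTranspose_mul {𝕂 : Type*} [RCLike 𝕂] {ι κ : Type*} [Fintype ι] [Fintype κ]
    (T G : Matrix ι κ 𝕂) :
    RCLike.re (trace (Tᴴ * G)) = ∑ x : ι × κ, RCLike.re (star (T x.1 x.2) * G x.1 x.2) := by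
  simp only [trace, diag_apply, mul_apply, conjTranspose_apply, map_sum]
  rw [Fintype.sum_prod_type, Finset.sum_comm]

theorem frobenius_normSq {𝕂 : Type*} [RCLike 𝕂] {ι κ : Type*} [Fintype ι] [Fintype κ]
    (T : Matrix ι κ 𝕂) : ‖T‖ ^ 2 = ∑ x : ι × κ, ‖T x.1 x.2‖ ^ 2 := by
  rw [frobenius_norm_def, ← Real.sqrt_eq_rpow, Real.sq_sqrt (by positivity),
    Fintype.sum_prod_type]
  simp

theorem frobenius_normSq_eq_re_trace {𝕂 : Type*} [RCLike 𝕂] {ι κ : Type*} [Fintype ι] [Fintype κ]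
    (T : Matrix ι κ 𝕂) : ‖T‖ ^ 2 = RCLike.re (trace (Tᴴ * T)) := by
  rw [frobenius_normSq, re_trace_conjTranspose_mul]
  simp [RCLike.norm_sq_eq_def]

theorem measurable_matrix_iff {𝕂 : Type*} [RCLike 𝕂] {X : Type*} [MeasurableSpace X] {m k : ℕ}
    {f : X → Matrix (Fin m) (Fin k) 𝕂} : Measurable f ↔ ∀ i j, Measurable fun x => f x i j := by
  constructor
  · intro h i j
    exact (measurable_pi_apply j).comp ((measurable_pi_apply i).comp h)
  · intro h
    exact measurable_pi_iff.mpr fun i => measurable_pi_iff.mpr fun j => h i j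

theorem measurable_matrix_apply {𝕂 : Type*} [RCLike 𝕂] {m k : ℕ} (i : Fin m) (j : Fin k) :
    Measurable fun M : Matrix (Fin m) (Fin k) 𝕂 => M i j :=
  measurable_matrix_iff.mp measurable_id i j

theorem Measurable.matrix_mul {𝕂 : Type*} [RCLike 𝕂] {X : Type*} [MeasurableSpace X]
    {a b c : ℕ} {f : X → Matrix (Fin a) (Fin b) 𝕂} {g : X → Matrix (Fin b) (Fin c) 𝕂}
    (hf : Measurable f) (hg : Measurable g) : Measurable fun x => f x * g x := by
  rw [measurable_matrix_iff] at *
  intro i j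
  simp only [mul_apply]
  exact Finset.measurable_sum _ fun q _ => (hf i q).mul (hg q j)

theorem Measurable.matrix_add {𝕂 : Type*} [RCLike 𝕂] {X : Type*} [MeasurableSpace X]
    {a b : ℕ} {f g : X → Matrix (Fin a) (Fin b) 𝕂}
    (hf : Measurable f) (hg : Measurable g) : Measurable fun x => f x + g x := by
  rw [measurable_matrix_iff] at *
  exact fun i j => (hf i j).add (hg i j)

theorem Measurable.matrix_conjTranspose {𝕂 : Type*} [RCLike 𝕂] {X : Type*} [MeasurableSpace X]
    {a b : ℕ} {f : X → Matrix (Fin a) (Fin b) 𝕂}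
    (hf : Measurable f) : Measurable fun x => (f x)ᴴ := by
  rw [measurable_matrix_iff] at *
  exact fun i j => (continuous_star.measurable).comp (hf j i)

theorem Measurable.matrix_det {𝕂 : Type*} [RCLike 𝕂] {X : Type*} [MeasurableSpace X]
    {a : ℕ} {f : X → Matrix (Fin a) (Fin a) 𝕂}
    (hf : Measurable f) : Measurable fun x => (f x).det := by
  rw [measurable_matrix_iff] at hf
  simp only [det_apply]
  refine Finset.measurable_sum _ fun σ _ => ?_
  exact (Finset.measurable_prod _ fun i _ => hf _ _).const_smul _

/-- Cramer's rule: each entry is a determinant times the total field inverse of a determinant, so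
singular matrices need no separate case. -/
theorem Measurable.matrix_inv {𝕂 : Type*} [RCLike 𝕂] {X : Type*} [MeasurableSpace X]
    {a : ℕ} {f : X → Matrix (Fin a) (Fin a) 𝕂}
    (hf : Measurable f) : Measurable fun x => (f x)⁻¹ := by
  rw [measurable_matrix_iff]
  intro i j
  simp only [inv_def, Ring.inverse_eq_inv', Matrix.smul_apply, smul_eq_mul, adjugate_apply]
  refine (Measurable.matrix_det hf).inv.mul (Measurable.matrix_det ?_)
  rw [measurable_matrix_iff] at *
  intro i' j'
  simp only [updateRow_apply]
  split_ifs
  · exact measurable_const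
  · exact hf _ _

theorem Measurable.matrix_trace {𝕂 : Type*} [RCLike 𝕂] {X : Type*} [MeasurableSpace X]
    {a : ℕ} {f : X → Matrix (Fin a) (Fin a) 𝕂}
    (hf : Measurable f) : Measurable fun x => (f x).trace := by
  rw [measurable_matrix_iff] at hf
  exact Finset.measurable_sum _ fun i _ => hf i i

theorem Measurable.frobenius_normSq {𝕂 : Type*} [RCLike 𝕂] {X : Type*} [MeasurableSpace X]
    {a b : ℕ} {f : X → Matrix (Fin a) (Fin b) 𝕂}
    (hf : Measurable f) : Measurable fun x => ‖f x‖ ^ 2 := by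
  rw [measurable_matrix_iff] at hf
  simp only [SketchSolve.frobenius_normSq]
  exact Finset.measurable_sum _ fun x _ => (hf x.1 x.2).norm.pow_const 2

theorem aemeasurable_matrix_of_entries {𝕂 : Type*} [RCLike 𝕂] {X : Type*} [MeasurableSpace X]
    {ρ : Measure X} {m k : ℕ} {f : X → Matrix (Fin m) (Fin k) 𝕂}
    (h : ∀ i j, AEMeasurable (fun x => f x i j) ρ) : AEMeasurable f ρ :=
  aemeasurable_pi_lambda _ fun i => aemeasurable_pi_lambda _ fun j => h i j

/-! ### Gaussian matrices -/

/-- The law of an `m × k` matrix of independent standard normal variables. -/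
noncomputable def gaussianMatrix (𝕂 : Type*) [RCLike 𝕂] (m k : ℕ) :
    Measure (Matrix (Fin m) (Fin k) 𝕂) :=
  (Measure.pi fun _ : Fin m × Fin k => stdNormal 𝕂).map fun x => Matrix.of fun i j => x (i, j)

theorem measurable_of_pairs {𝕂 : Type*} [RCLike 𝕂] {m k : ℕ} :
    Measurable fun x : Fin m × Fin k → 𝕂 =>
      (Matrix.of fun i j => x (i, j) : Matrix (Fin m) (Fin k) 𝕂) :=
  measurable_matrix_iff.mpr fun i j => measurable_pi_apply (i, j)

theorem measurable_pairs {𝕂 : Type*} [RCLike 𝕂] {m k : ℕ} :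
    Measurable fun (M : Matrix (Fin m) (Fin k) 𝕂) (x : Fin m × Fin k) => M x.1 x.2 :=
  measurable_pi_iff.mpr fun x => measurable_matrix_apply x.1 x.2

instance isProbabilityMeasure_gaussianMatrix {𝕂 : Type*} [RCLike 𝕂] {m k : ℕ} :
    IsProbabilityMeasure (gaussianMatrix 𝕂 m k) :=
  Measure.isProbabilityMeasure_map measurable_of_pairs.aemeasurable

theorem measurable_re_trace {𝕂 : Type*} [RCLike 𝕂] {m k : ℕ} (T : Matrix (Fin m) (Fin k) 𝕂) :
    Measurable fun G : Matrix (Fin m) (Fin k) 𝕂 => RCLike.re (trace (Tᴴ * G)) :=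
  RCLike.measurable_re.comp
    (Measurable.matrix_trace (Measurable.matrix_mul measurable_const measurable_id))

theorem measurable_exp_re_trace {𝕂 : Type*} [RCLike 𝕂] {m k : ℕ} (T : Matrix (Fin m) (Fin k) 𝕂) :
    Measurable fun G : Matrix (Fin m) (Fin k) 𝕂 =>
      Complex.exp ((RCLike.re (trace (Tᴴ * G)) : ℝ) * Complex.I) := by
  have := measurable_re_trace T
  fun_prop

/-- The characteristic function of a Gaussian matrix. -/
theorem integral_exp_gaussianMatrix {𝕂 : Type*} [RCLike 𝕂] {m k : ℕ}
    (T : Matrix (Fin m) (Fin k) 𝕂) :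
    ∫ G, Complex.exp ((RCLike.re (trace (Tᴴ * G)) : ℝ) * Complex.I) ∂(gaussianMatrix 𝕂 m k) =
      Complex.exp ((-((1 + alpha 𝕂 : ℝ) / 4 * ‖T‖ ^ 2) : ℝ) : ℂ) := by
  rw [gaussianMatrix, integral_map measurable_of_pairs.aemeasurable
    (measurable_exp_re_trace T).aestronglyMeasurable]
  simp only [re_trace_conjTranspose_mul, of_apply, Prod.mk.eta, Complex.ofReal_sum,
    Finset.sum_mul, Complex.exp_sum]
  rw [integral_fintype_prod_eq_prod (fun (x : Fin m × Fin k) (z : 𝕂) =>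
    Complex.exp ((RCLike.re (star (T x.1 x.2) * z) : ℝ) * Complex.I))]
  simp only [integral_exp_re_stdNormal]
  rw [← Complex.exp_sum, frobenius_normSq, Finset.mul_sum, ← Complex.ofReal_sum,
    Finset.sum_neg_distrib]

/-- The real pairing `∑ᵢ Re (conj (wᵢ) vᵢ)`. -/
noncomputable def rePairing (𝕂 : Type*) [RCLike 𝕂] (ι : Type*) [Fintype ι] :
    (ι → 𝕂) →ₗ[ℝ] (ι → 𝕂) →ₗ[ℝ] ℝ :=
  LinearMap.mk₂ ℝ (fun v w => ∑ i, RCLike.re (star (w i) * v i))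
    (fun a b c => by simp [mul_add, Finset.sum_add_distrib])
    (fun r a b => by
      simp only [Pi.smul_apply, mul_smul_comm, RCLike.smul_re, smul_eq_mul,
        Finset.mul_sum])
    (fun a b c => by simp [add_mul, Finset.sum_add_distrib])
    (fun r a b => by
      simp only [Pi.smul_apply, star_smul, star_trivial, smul_mul_assoc, RCLike.smul_re,
        smul_eq_mul, Finset.mul_sum])

theorem rePairing_apply {𝕂 : Type*} [RCLike 𝕂] {ι : Type*} [Fintype ι] (v w : ι → 𝕂) :
    rePairing 𝕂 ι v w = ∑ i, RCLike.re (star (w i) * v i) := rfl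

/-- A law on matrices is determined by its characteristic function. -/
theorem matrix_measure_ext {𝕂 : Type*} [RCLike 𝕂] {m k : ℕ}
    {ρ σ : Measure (Matrix (Fin m) (Fin k) 𝕂)} [IsFiniteMeasure ρ] [IsFiniteMeasure σ]
    (h : ∀ T : Matrix (Fin m) (Fin k) 𝕂,
      ∫ G, Complex.exp ((RCLike.re (trace (Tᴴ * G)) : ℝ) * Complex.I) ∂ρ =
        ∫ G, Complex.exp ((RCLike.re (trace (Tᴴ * G)) : ℝ) * Complex.I) ∂σ) : ρ = σ := by
  set u := fun (M : Matrix (Fin m) (Fin k) 𝕂) (x : Fin m × Fin k) => M x.1 x.2 with hu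
  have hL : Continuous fun p : (Fin m × Fin k → 𝕂) × (Fin m × Fin k → 𝕂) =>
      rePairing 𝕂 (Fin m × Fin k) p.1 p.2 := by
    simp only [rePairing_apply]
    refine continuous_finsetSum _ fun i _ => RCLike.continuous_re.comp ?_
    fun_prop
  have key : ρ.map u = σ.map u := by
    refine ext_of_integral_char_eq Real.continuous_probChar Real.probChar_ne_one
      (L := rePairing 𝕂 (Fin m × Fin k)) ?_ hL ?_
    -- Nondegeneracy: pairing `v` with itself gives the sum of its squared moduli.
    · intro v hv h0
      apply hv
      have h1 := LinearMap.congr_fun h0 v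
      rw [rePairing_apply] at h1
      have h2 : ∑ i, ‖v i‖ ^ 2 = 0 := by
        refine Eq.trans ?_ h1
        simp [RCLike.norm_sq_eq_def]
      rw [Finset.sum_eq_zero_iff_of_nonneg (fun i _ => by positivity)] at h2
      ext i
      simpa using h2 i (Finset.mem_univ i)
    · intro w
      have hm : Measurable fun v : Fin m × Fin k → 𝕂 =>
          (BoundedContinuousFunction.char Real.continuous_probChar hL w) v :=
        (BoundedContinuousFunction.continuous _).measurable
      rw [integral_map measurable_pairs.aemeasurable hm.aestronglyMeasurable,
        integral_map measurable_pairs.aemeasurable hm.aestronglyMeasurable]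
      have := h (Matrix.of fun i j => w (i, j))
      simp only [re_trace_conjTranspose_mul, of_apply, Prod.mk.eta] at this
      exact this
  have back : ∀ τ : Measure (Matrix (Fin m) (Fin k) 𝕂),
      (τ.map u).map (fun x => Matrix.of fun i j => x (i, j)) = τ := by
    intro τ
    rw [Measure.map_map measurable_of_pairs measurable_pairs]
    exact Measure.map_id
  rw [← back ρ, ← back σ, key]

theorem map_eq_gaussianMatrix {𝕂 : Type*} [RCLike 𝕂] {m k : ℕ} {X : Type*} [MeasurableSpace X]
    {ρ : Measure X} [IsFiniteMeasure ρ] {f : X → Matrix (Fin m) (Fin k) 𝕂}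
    (hf : AEMeasurable f ρ)
    (h : ∀ T : Matrix (Fin m) (Fin k) 𝕂,
      ∫ x, Complex.exp ((RCLike.re (trace (Tᴴ * f x)) : ℝ) * Complex.I) ∂ρ =
        Complex.exp ((-((1 + alpha 𝕂 : ℝ) / 4 * ‖T‖ ^ 2) : ℝ) : ℂ)) :
    ρ.map f = gaussianMatrix 𝕂 m k := by
  refine matrix_measure_ext fun T => ?_
  rw [integral_map hf (measurable_exp_re_trace T).aestronglyMeasurable, h,
    integral_exp_gaussianMatrix]

/-- The image of a Gaussian matrix under a map with an isometric adjoint is Gaussian. -/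
theorem gaussianMatrix_map {𝕂 : Type*} [RCLike 𝕂] {a b m k : ℕ}
    {f : Matrix (Fin a) (Fin b) 𝕂 → Matrix (Fin m) (Fin k) 𝕂} (hf : Measurable f)
    (g : Matrix (Fin m) (Fin k) 𝕂 → Matrix (Fin a) (Fin b) 𝕂)
    (hg : ∀ T G, RCLike.re (trace (Tᴴ * f G)) = RCLike.re (trace ((g T)ᴴ * G)))
    (hn : ∀ T, ‖g T‖ ^ 2 = ‖T‖ ^ 2) :
    (gaussianMatrix 𝕂 a b).map f = gaussianMatrix 𝕂 m k := by
  refine map_eq_gaussianMatrix hf.aemeasurable fun T => ?_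
  simp only [hg]
  rw [integral_exp_gaussianMatrix, hn]

/-- The image of a pair of independent Gaussian matrices under a map with an isometric adjoint
is Gaussian. -/
theorem gaussianMatrix_prod_map {𝕂 : Type*} [RCLike 𝕂] {a b a' b' m k : ℕ}
    {f : Matrix (Fin a) (Fin b) 𝕂 × Matrix (Fin a') (Fin b') 𝕂 → Matrix (Fin m) (Fin k) 𝕂}
    (hf : Measurable f)
    (g : Matrix (Fin m) (Fin k) 𝕂 → Matrix (Fin a) (Fin b) 𝕂)
    (g' : Matrix (Fin m) (Fin k) 𝕂 → Matrix (Fin a') (Fin b') 𝕂)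
    (hg : ∀ T x, RCLike.re (trace (Tᴴ * f x)) =
      RCLike.re (trace ((g T)ᴴ * x.1)) + RCLike.re (trace ((g' T)ᴴ * x.2)))
    (hn : ∀ T, ‖g T‖ ^ 2 + ‖g' T‖ ^ 2 = ‖T‖ ^ 2) :
    ((gaussianMatrix 𝕂 a b).prod (gaussianMatrix 𝕂 a' b')).map f = gaussianMatrix 𝕂 m k := by
  refine map_eq_gaussianMatrix hf.aemeasurable fun T => ?_
  simp only [hg, Complex.ofReal_add, add_mul, Complex.exp_add]
  rw [integral_prod_mul
    (fun G => Complex.exp ((RCLike.re (trace ((g T)ᴴ * G)) : ℝ) * Complex.I))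
    (fun G => Complex.exp ((RCLike.re (trace ((g' T)ᴴ * G)) : ℝ) * Complex.I)),
    integral_exp_gaussianMatrix, integral_exp_gaussianMatrix, ← Complex.exp_add, ← hn,
    ← Complex.ofReal_add]
  congr 2
  ring

/-! ### Orthogonal transformations of Gaussian matrices -/

/-- The adjoint `T ↦ Uᴴ * T` is isometric as soon as the rows of `U` are orthonormal. Compressions
`G ↦ Qᴴ * G` by an isometry are therefore covered along with rotations. -/
theorem gaussianMatrix_map_mul_left {𝕂 : Type*} [RCLike 𝕂] {m m' k : ℕ}
    {U : Matrix (Fin m') (Fin m) 𝕂} (hU : U * Uᴴ = 1) :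
    (gaussianMatrix 𝕂 m k).map (fun G => U * G) = gaussianMatrix 𝕂 m' k := by
  refine gaussianMatrix_map (Measurable.matrix_mul measurable_const measurable_id)
    (fun T => Uᴴ * T) (fun T G => ?_) (fun T => ?_)
  · rw [conjTranspose_mul, conjTranspose_conjTranspose, Matrix.mul_assoc]
  · rw [frobenius_normSq_eq_re_trace, frobenius_normSq_eq_re_trace, conjTranspose_mul,
      conjTranspose_conjTranspose, Matrix.mul_assoc, ← Matrix.mul_assoc U, hU, Matrix.one_mul]

theorem gaussianMatrix_map_mul_right {𝕂 : Type*} [RCLike 𝕂] {m k k' : ℕ}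
    {U : Matrix (Fin k) (Fin k') 𝕂} (hU : Uᴴ * U = 1) :
    (gaussianMatrix 𝕂 m k).map (fun G => G * U) = gaussianMatrix 𝕂 m k' := by
  refine gaussianMatrix_map (Measurable.matrix_mul measurable_id measurable_const)
    (fun T => T * Uᴴ) (fun T G => ?_) (fun T => ?_)
  · rw [conjTranspose_mul, conjTranspose_conjTranspose, ← Matrix.mul_assoc, trace_mul_comm,
      Matrix.mul_assoc]
  · rw [frobenius_normSq_eq_re_trace, frobenius_normSq_eq_re_trace, conjTranspose_mul,
      conjTranspose_conjTranspose, trace_mul_comm, Matrix.mul_assoc, ← Matrix.mul_assoc Uᴴ, hU,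
      Matrix.one_mul, trace_mul_comm]

/-- If `[P P']` is unitary, then `P N + P' W` is Gaussian for independent Gaussian `N`, `W`. -/
theorem gaussianMatrix_prod_map_mul_left {𝕂 : Type*} [RCLike 𝕂] {a a' m k : ℕ}
    {P : Matrix (Fin m) (Fin a) 𝕂} {P' : Matrix (Fin m) (Fin a') 𝕂}
    (hP : P * Pᴴ + P' * P'ᴴ = 1) :
    ((gaussianMatrix 𝕂 a k).prod (gaussianMatrix 𝕂 a' k)).map (fun x => P * x.1 + P' * x.2) =
      gaussianMatrix 𝕂 m k := by
  refine gaussianMatrix_prod_map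
    (Measurable.matrix_add (Measurable.matrix_mul measurable_const measurable_fst)
      (Measurable.matrix_mul measurable_const measurable_snd))
    (fun T => Pᴴ * T) (fun T => P'ᴴ * T) (fun T x => ?_) (fun T => ?_)
  · simp only [conjTranspose_mul, conjTranspose_conjTranspose, Matrix.mul_assoc, Matrix.mul_add,
      trace_add, map_add]
  · simp only [frobenius_normSq_eq_re_trace, conjTranspose_mul, conjTranspose_conjTranspose]
    rw [← map_add, ← trace_add]
    congr 2
    calc Tᴴ * P * (Pᴴ * T) + Tᴴ * P' * (P'ᴴ * T) = Tᴴ * (P * Pᴴ + P' * P'ᴴ) * T := by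
          simp only [Matrix.mul_add, Matrix.add_mul, Matrix.mul_assoc]
      _ = Tᴴ * T := by rw [hP, Matrix.mul_one]

/-- If `[P P']` is unitary, then `N Pᴴ + W P'ᴴ` is Gaussian for independent Gaussian `N`, `W`. -/
theorem gaussianMatrix_prod_map_mul_right {𝕂 : Type*} [RCLike 𝕂] {a a' m k : ℕ}
    {P : Matrix (Fin m) (Fin a) 𝕂} {P' : Matrix (Fin m) (Fin a') 𝕂}
    (hP : P * Pᴴ + P' * P'ᴴ = 1) :
    ((gaussianMatrix 𝕂 k a).prod (gaussianMatrix 𝕂 k a')).map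
      (fun x => x.1 * Pᴴ + x.2 * P'ᴴ) = gaussianMatrix 𝕂 k m := by
  refine gaussianMatrix_prod_map
    (Measurable.matrix_add (Measurable.matrix_mul measurable_fst measurable_const)
      (Measurable.matrix_mul measurable_snd measurable_const))
    (fun T => T * P) (fun T => T * P') (fun T x => ?_) (fun T => ?_)
  · simp only [conjTranspose_mul, Matrix.mul_add, trace_add, map_add]
    rw [← Matrix.mul_assoc, trace_mul_comm, ← Matrix.mul_assoc, ← Matrix.mul_assoc,
      trace_mul_comm (Tᴴ * x.2), ← Matrix.mul_assoc]
  · simp only [frobenius_normSq_eq_re_trace, conjTranspose_mul]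
    rw [trace_mul_comm, trace_mul_comm (P'ᴴ * Tᴴ), ← map_add, ← trace_add, trace_mul_comm Tᴴ]
    congr 2
    calc T * P * (Pᴴ * Tᴴ) + T * P' * (P'ᴴ * Tᴴ) = T * (P * Pᴴ + P' * P'ᴴ) * Tᴴ := by
          simp only [Matrix.mul_add, Matrix.add_mul, Matrix.mul_assoc]
      _ = T * Tᴴ := by rw [hP, Matrix.mul_one]

/-! ### Second moments of Gaussian matrices -/

/-- A linear functional of unit norm maps a Gaussian matrix to a standard normal scalar, treated
here as a `1 × 1` Gaussian matrix; the general case is a rescaling. -/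
theorem lintegral_normSq_trace_gaussianMatrix {𝕂 : Type*} [RCLike 𝕂] {m k : ℕ}
    (T : Matrix (Fin m) (Fin k) 𝕂) :
    ∫⁻ G, ENNReal.ofReal (‖trace (Tᴴ * G)‖ ^ 2) ∂(gaussianMatrix 𝕂 m k) =
      ENNReal.ofReal (‖T‖ ^ 2) := by
  by_cases hT : T = 0
  · simp [hT]
  have hT0 : ‖T‖ ≠ 0 := norm_ne_zero_iff.mpr hT
  have htr : Measurable fun G : Matrix (Fin m) (Fin k) 𝕂 => trace (Tᴴ * G) :=
    Measurable.matrix_trace (Measurable.matrix_mul measurable_const measurable_id)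
  have hf : Measurable fun G : Matrix (Fin m) (Fin k) 𝕂 =>
      (Matrix.of fun _ _ => ((‖T‖⁻¹ : ℝ) : 𝕂) * trace (Tᴴ * G) : Matrix (Fin 1) (Fin 1) 𝕂) :=
    measurable_matrix_iff.mpr fun i j => htr.const_mul _
  have hlaw := gaussianMatrix_map hf
    (fun S => (((‖T‖⁻¹ : ℝ) : 𝕂) * S 0 0) • T) (fun S G => by
      rw [conjTranspose_smul, Matrix.smul_mul, trace_smul]
      generalize trace (Tᴴ * G) = c
      rw [trace_fin_one, mul_apply, Fin.sum_univ_one]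
      simp only [conjTranspose_apply, of_apply, smul_eq_mul, star_mul', RCLike.star_def,
        RCLike.conj_ofReal]
      congr 1
      ring) (fun S => by
      rw [frobenius_normSq, frobenius_normSq]
      simp only [Matrix.smul_apply, norm_smul, mul_pow, ← Finset.mul_sum]
      rw [← frobenius_normSq, norm_mul, RCLike.norm_ofReal, abs_of_nonneg (by positivity)]
      simp [Fintype.sum_prod_type]
      field_simp)
  have h1 : ∫⁻ S, ENNReal.ofReal (‖S 0 0‖ ^ 2) ∂(gaussianMatrix 𝕂 1 1) = 1 := by
    rw [gaussianMatrix, lintegral_map _ measurable_of_pairs]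
    · simp only [of_apply]
      have := (measurePreserving_eval (fun _ : Fin 1 × Fin 1 => stdNormal 𝕂) (0, 0)).lintegral_comp
        (f := fun z => ENNReal.ofReal (‖z‖ ^ 2)) (by fun_prop)
      rw [← lintegral_normSq_stdNormal (𝕂 := 𝕂), ← this]
    · have := measurable_matrix_apply (𝕂 := 𝕂) (0 : Fin 1) (0 : Fin 1)
      fun_prop
  rw [← hlaw, lintegral_map _ hf] at h1
  · have e : ∀ G : Matrix (Fin m) (Fin k) 𝕂, ENNReal.ofReal (‖trace (Tᴴ * G)‖ ^ 2) =
        ENNReal.ofReal (‖T‖ ^ 2) *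
          ENNReal.ofReal (‖((‖T‖⁻¹ : ℝ) : 𝕂) * trace (Tᴴ * G)‖ ^ 2) := by
      intro G
      rw [← ENNReal.ofReal_mul (by positivity), norm_mul, RCLike.norm_ofReal,
        abs_of_nonneg (by positivity)]
      congr 1
      field_simp
    simp only [of_apply] at h1
    simp only [e]
    rw [lintegral_const_mul _ (by fun_prop), h1, mul_one]
  · have := measurable_matrix_apply (𝕂 := 𝕂) (0 : Fin 1) (0 : Fin 1)
    fun_prop

/-- Each entry of `X * G * Y` is the functional of `G` given by the outer product of a row of `X`
and a column of `Y`, and norms of outer products multiply. -/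
theorem lintegral_normSq_mul_mul_gaussianMatrix {𝕂 : Type*} [RCLike 𝕂] {a m k b : ℕ}
    (X : Matrix (Fin a) (Fin m) 𝕂) (Y : Matrix (Fin k) (Fin b) 𝕂) :
    ∫⁻ G, ENNReal.ofReal (‖X * G * Y‖ ^ 2) ∂(gaussianMatrix 𝕂 m k) =
      ENNReal.ofReal (‖X‖ ^ 2 * ‖Y‖ ^ 2) := by
  have e : ∀ (G : Matrix (Fin m) (Fin k) 𝕂) (x : Fin a × Fin b), (X * G * Y) x.1 x.2 =
      trace ((Matrix.of fun i j => star (X x.1 i) * star (Y j x.2))ᴴ * G) := by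
    intro G x
    simp only [trace, diag_apply, mul_apply, conjTranspose_apply, of_apply, star_mul', star_star,
      Finset.sum_mul]
    refine Finset.sum_congr rfl fun j _ => Finset.sum_congr rfl fun i _ => by ring
  simp only [fun G : Matrix (Fin m) (Fin k) 𝕂 => frobenius_normSq (X * G * Y), e]
  simp only [ENNReal.ofReal_sum_of_nonneg (fun _ _ => sq_nonneg _)]
  rw [lintegral_finsetSum']
  · simp only [lintegral_normSq_trace_gaussianMatrix]
    rw [← ENNReal.ofReal_sum_of_nonneg (fun _ _ => sq_nonneg _)]
    congr 1
    simp only [frobenius_normSq, of_apply, norm_mul, norm_star, mul_pow, Fintype.sum_prod_type,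
      Finset.sum_mul_sum]
    refine Finset.sum_congr rfl fun i _ => ?_
    rw [Finset.sum_comm, Finset.sum_comm (s := (Finset.univ : Finset (Fin k)))]
    exact Finset.sum_congr rfl fun j _ => Finset.sum_comm
  · intro x _
    have := Measurable.matrix_trace (Measurable.matrix_mul (measurable_const
      (a := (Matrix.of fun i j => star (X x.1 i) * star (Y j x.2))ᴴ)) (measurable_id
        (α := Matrix (Fin m) (Fin k) 𝕂)))
    exact (this.norm.pow_const 2).ennreal_ofReal.aemeasurable

theorem IsGaussian.aemeasurable {𝕂 : Type*} [RCLike 𝕂] {S : Type*} [MeasurableSpace S]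
    {μ : Measure S} {n l : ℕ} {Ω : S → Matrix (Fin n) (Fin l) 𝕂} (h : IsGaussian Ω μ) :
    AEMeasurable Ω μ :=
  aemeasurable_matrix_of_entries fun i j => (h.law i j).aemeasurable

/-- A random matrix with independent standard normal entries has the law `gaussianMatrix`. -/
theorem IsGaussian.map_eq {𝕂 : Type*} [RCLike 𝕂] {S : Type*} [MeasurableSpace S]
    {μ : Measure S} [IsProbabilityMeasure μ] {n l : ℕ} {Ω : S → Matrix (Fin n) (Fin l) 𝕂}
    (h : IsGaussian Ω μ) : μ.map Ω = gaussianMatrix 𝕂 n l := by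
  have hae : ∀ x : Fin n × Fin l, AEMeasurable (fun ω => Ω ω x.1 x.2) μ :=
    fun x => (h.law x.1 x.2).aemeasurable
  have h1 := (iIndepFun_iff_map_fun_eq_pi_map hae).mp h.indep
  simp only [(h.law _ _).map_eq] at h1
  rw [gaussianMatrix, ← h1,
    AEMeasurable.map_map_of_aemeasurable measurable_of_pairs.aemeasurable
      (aemeasurable_pi_lambda _ hae)]
  rfl

/-! ### Isometries, factorizations and pseudoinverses -/

theorem inner_toLp_col {𝕂 : Type*} [RCLike 𝕂] {n : ℕ} {ι κ : Type*}
    (Q : Matrix (Fin n) ι 𝕂) (R : Matrix (Fin n) κ 𝕂) (i : ι) (j : κ) :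
    inner 𝕂 (WithLp.toLp 2 fun a => Q a i : EuclideanSpace 𝕂 (Fin n))
      (WithLp.toLp 2 fun a => R a j) = (Qᴴ * R) i j := by
  simp [PiLp.inner_apply, mul_apply, mul_comm]

/-- The columns of an isometry extend to an orthonormal basis. -/
theorem exists_orthogonal_complement {𝕂 : Type*} [RCLike 𝕂] {ι : Type*} [Fintype ι]
    [DecidableEq ι] {n k : ℕ} (hk : Fintype.card ι + k = n) (Q : Matrix (Fin n) ι 𝕂)
    (hQ : Qᴴ * Q = 1) : ∃ Q' : Matrix (Fin n) (Fin k) 𝕂,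
      Q'ᴴ * Q' = 1 ∧ Qᴴ * Q' = 0 ∧ Q * Qᴴ + Q' * Q'ᴴ = 1 := by
  classical
  -- The zeros are placeholders: the basis extension keeps `v` only on the range of `Sum.inl`.
  set v : ι ⊕ Fin k → EuclideanSpace 𝕂 (Fin n) :=
    Sum.elim (fun i => WithLp.toLp 2 fun a => Q a i) 0
  have hv : Orthonormal 𝕂 ((Set.range Sum.inl).domRestrict v) := by
    rw [orthonormal_iff_ite]
    rintro ⟨_, i, rfl⟩ ⟨_, j, rfl⟩
    change inner 𝕂 (WithLp.toLp 2 fun a => Q a i : EuclideanSpace 𝕂 (Fin n))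
      (WithLp.toLp 2 fun a => Q a j) = _
    rw [inner_toLp_col, hQ, one_apply]
    exact if_congr ⟨fun h => by subst h; rfl,
      fun h => Sum.inl_injective (congrArg Subtype.val h)⟩ rfl rfl
  obtain ⟨b, hb⟩ := hv.exists_orthonormalBasis_extension_of_card_eq (by simp [hk])
  set Q' : Matrix (Fin n) (Fin k) 𝕂 := Matrix.of fun a j => b (Sum.inr j) a
  have hl : ∀ i, b (Sum.inl i) = WithLp.toLp 2 fun a => Q a i := fun i => hb _ ⟨i, rfl⟩
  have hr : ∀ j, b (Sum.inr j) = WithLp.toLp 2 fun a => Q' a j := fun j => rfl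
  have h1 : Q'ᴴ * Q' = 1 := by
    ext i j
    rw [← inner_toLp_col, ← hr, ← hr, b.inner_eq_ite, one_apply]
    simp
  have h2 : Qᴴ * Q' = 0 := by
    ext i j
    rw [← inner_toLp_col, ← hl, ← hr, b.inner_eq_ite]
    simp
  refine ⟨Q', h1, h2, ?_⟩
  have h3 : Q'ᴴ * Q = 0 := by
    rw [← conjTranspose_conjTranspose Q, ← conjTranspose_mul, h2, conjTranspose_zero]
  -- The square matrix `[Q Q']` has a left inverse, hence the same right inverse; this is the
  -- resolution of the identity.
  have h4 : fromRows Qᴴ Q'ᴴ * fromCols Q Q' = 1 := by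
    rw [fromRows_mul_fromCols, hQ, h1, h2, h3, fromBlocks_one]
  have h5 := (mul_eq_one_comm_of_card_eq _ _ 𝕂 (by simp [hk])).mp h4
  rwa [fromCols_mul_fromRows] at h5

/-- Any two isometries of the same shape differ by a unitary. -/
theorem exists_unitary_mul_eq {𝕂 : Type*} [RCLike 𝕂] {ι : Type*} [Fintype ι]
    [DecidableEq ι] {n : ℕ} (hι : Fintype.card ι ≤ n) {Q R : Matrix (Fin n) ι 𝕂}
    (hQ : Qᴴ * Q = 1) (hR : Rᴴ * R = 1) : ∃ U ∈ Matrix.unitaryGroup (Fin n) 𝕂, U * Q = R := by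
  obtain ⟨k, hk⟩ := Nat.exists_eq_add_of_le hι
  obtain ⟨Q', h1, h2, h3⟩ := exists_orthogonal_complement hk.symm Q hQ
  obtain ⟨R', g1, g2, g3⟩ := exists_orthogonal_complement hk.symm R hR
  have h4 : Q'ᴴ * Q = 0 := by
    rw [← conjTranspose_conjTranspose Q, ← conjTranspose_mul, h2, conjTranspose_zero]
  -- This carries the orthonormal basis `[Q Q']` to `[R R']`.
  refine ⟨R * Qᴴ + R' * Q'ᴴ, ?_, ?_⟩
  · rw [mem_unitaryGroup_iff, star_eq_conjTranspose, conjTranspose_add, conjTranspose_mul,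
      conjTranspose_mul, conjTranspose_conjTranspose, conjTranspose_conjTranspose, Matrix.add_mul,
      Matrix.mul_add, Matrix.mul_add, Matrix.mul_assoc, Matrix.mul_assoc, ← Matrix.mul_assoc Qᴴ,
      ← Matrix.mul_assoc Qᴴ, Matrix.mul_assoc R', Matrix.mul_assoc R', ← Matrix.mul_assoc Q'ᴴ,
      ← Matrix.mul_assoc Q'ᴴ, hQ, h1, h2, h4]
    simpa using g3
  · rw [Matrix.add_mul, Matrix.mul_assoc, Matrix.mul_assoc, hQ, h4]
    simp

theorem isUnit_det_of_rank_eq {𝕂 : Type*} [RCLike 𝕂] {r : ℕ} {M : Matrix (Fin r) (Fin r) 𝕂}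
    (h : M.rank = r) : IsUnit M.det := by
  rw [← isUnit_iff_isUnit_det, ← mulVec_surjective_iff_isUnit]
  have : LinearMap.range M.mulVecLin = ⊤ := by
    apply Submodule.eq_top_of_finrank_eq
    rw [← Matrix.rank, h]
    simp
  exact LinearMap.range_eq_top.mp this

open scoped ComplexOrder in
/-- Every matrix of rank `r` is the product of an isometry with `r` columns and a matrix of
full row rank. -/
theorem exists_isometry_mul {𝕂 : Type*} [RCLike 𝕂] {n d r : ℕ} (A : Matrix (Fin n) (Fin d) 𝕂)
    (hr : A.rank = r) : ∃ (Q : Matrix (Fin n) (Fin r) 𝕂) (T : Matrix (Fin r) (Fin d) 𝕂),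
      Qᴴ * Q = 1 ∧ A = Q * T ∧ IsUnit (T * Tᴴ).det := by
  set V : Submodule 𝕂 (EuclideanSpace 𝕂 (Fin n)) :=
    (LinearMap.range A.mulVecLin).map (WithLp.linearEquiv 2 𝕂 (Fin n → 𝕂)).symm.toLinearMap
  have hV : Module.finrank 𝕂 V = r := by
    rw [← hr, Matrix.rank]
    exact LinearEquiv.finrank_map_eq _ _
  set b : OrthonormalBasis (Fin r) 𝕂 V := (stdOrthonormalBasis 𝕂 V).reindex (finCongr hV)
  set Q : Matrix (Fin n) (Fin r) 𝕂 := Matrix.of fun a j => (b j : EuclideanSpace 𝕂 (Fin n)) a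
  have hcol : ∀ j, (b j : EuclideanSpace 𝕂 (Fin n)) = WithLp.toLp 2 fun a => Q a j := fun j => rfl
  have hQ : Qᴴ * Q = 1 := by
    ext i j
    rw [← inner_toLp_col, ← hcol, ← hcol, ← Submodule.coe_inner, b.inner_eq_ite, one_apply]
  have hA : A = Q * (Qᴴ * A) := by
    ext a j
    have hmem : (WithLp.toLp 2 fun a => A a j : EuclideanSpace 𝕂 (Fin n)) ∈ V := by
      refine ⟨fun a => A a j, ⟨Pi.single j 1, ?_⟩, rfl⟩
      ext a
      simp
    have h1 := congrArg (fun x : V => (x : EuclideanSpace 𝕂 (Fin n)) a) (b.sum_repr' ⟨_, hmem⟩)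
    simp only [Submodule.coe_sum, Submodule.coe_smul, Submodule.coe_inner, hcol,
      inner_toLp_col] at h1
    rw [mul_apply]
    simpa [mul_comm] using h1.symm
  refine ⟨Q, Qᴴ * A, hQ, hA, isUnit_det_of_rank_eq ?_⟩
  rw [rank_self_mul_conjTranspose]
  apply le_antisymm
  · simpa using rank_le_card_height (Qᴴ * A)
  · conv_lhs => rw [← hr, hA]
    exact rank_mul_le_right _ _

theorem inv_isHermitian {𝕂 : Type*} [RCLike 𝕂] {r : ℕ} {M : Matrix (Fin r) (Fin r) 𝕂}
    (h : Mᴴ = M) : (M⁻¹)ᴴ = M⁻¹ := by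
  rw [conjTranspose_nonsing_inv, h]

/-- The pseudoinverse of a full-rank factorization. -/
theorem pinv_mul_eq {𝕂 : Type*} [RCLike 𝕂] {m r d : ℕ} {F : Matrix (Fin m) (Fin r) 𝕂}
    {T : Matrix (Fin r) (Fin d) 𝕂} (hF : IsUnit (Fᴴ * F).det) (hT : IsUnit (T * Tᴴ).det) :
    pinv (F * T) = Tᴴ * (T * Tᴴ)⁻¹ * ((Fᴴ * F)⁻¹ * Fᴴ) := by
  have hF1 : (Fᴴ * F)⁻¹ * Fᴴ * F = 1 := by rw [Matrix.mul_assoc, nonsing_inv_mul _ hF]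
  have hT1 : T * (Tᴴ * (T * Tᴴ)⁻¹) = 1 := by rw [← Matrix.mul_assoc, mul_nonsing_inv _ hT]
  have h1 : F * T * (Tᴴ * (T * Tᴴ)⁻¹ * ((Fᴴ * F)⁻¹ * Fᴴ)) = F * ((Fᴴ * F)⁻¹ * Fᴴ) := by
    rw [Matrix.mul_assoc, ← Matrix.mul_assoc T, hT1, Matrix.one_mul]
  have h2 : Tᴴ * (T * Tᴴ)⁻¹ * ((Fᴴ * F)⁻¹ * Fᴴ) * (F * T) = Tᴴ * (T * Tᴴ)⁻¹ * T := by
    rw [Matrix.mul_assoc _ _ (F * T), ← Matrix.mul_assoc _ F T, hF1, Matrix.one_mul]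
  refine (isMoorePenrose_pinv _).unique ⟨?_, ?_, ?_, ?_⟩
  · rw [h1, ← Matrix.mul_assoc, Matrix.mul_assoc F, hF1, Matrix.mul_one]
  · rw [h2, ← Matrix.mul_assoc, Matrix.mul_assoc _ T, hT1, Matrix.mul_one]
  · rw [h1, IsHermitian, conjTranspose_mul, conjTranspose_mul, conjTranspose_conjTranspose,
      inv_isHermitian (by simp), Matrix.mul_assoc]
  · rw [h2, IsHermitian, conjTranspose_mul, conjTranspose_mul, conjTranspose_conjTranspose,
      inv_isHermitian (by simp), Matrix.mul_assoc]

/-! ### The expected inverse of a Gaussian Gram matrix -/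

theorem lintegral_Ioi_of_hasDerivAt_of_nonneg {g g' : ℝ → ℝ} {a l : ℝ}
    (hderiv : ∀ x ∈ Set.Ici a, HasDerivAt g (g' x) x) (hpos : ∀ x ∈ Set.Ioi a, 0 ≤ g' x)
    (hg : Filter.Tendsto g Filter.atTop (nhds l)) :
    ∫⁻ x in Set.Ioi a, ENNReal.ofReal (g' x) = ENNReal.ofReal (l - g a) := by
  rw [← integral_Ioi_of_hasDerivAt_of_nonneg' hderiv hpos hg, ofReal_integral_eq_lintegral_ofReal
    (integrableOn_Ioi_deriv_of_nonneg' hderiv hpos hg)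
    ((ae_restrict_iff' measurableSet_Ioi).mpr (Filter.Eventually.of_forall hpos))]

/-- At `x = 0` both sides are infinite, so a random `x` can be substituted without excluding zero.
-/
theorem inv_ofReal_eq_lintegral_exp {x : ℝ} (hx : 0 ≤ x) :
    (ENNReal.ofReal x)⁻¹ = ∫⁻ t in Set.Ioi (0 : ℝ), ENNReal.ofReal (Real.exp (-(t * x))) := by
  rcases hx.eq_or_lt with rfl | hx
  · simp
  · have hd : ∀ t ∈ Set.Ici (0 : ℝ),
        HasDerivAt (fun t => -(x⁻¹ * Real.exp (-(t * x)))) (Real.exp (-(t * x))) t := by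
      intro t _
      have h1 : HasDerivAt (fun t : ℝ => -(t * x)) (-(1 * x)) t :=
        ((hasDerivAt_id t).mul_const x).neg
      refine (h1.exp.const_mul x⁻¹).fun_neg.congr_deriv ?_
      field_simp
    have hl : Filter.Tendsto (fun t => -(x⁻¹ * Real.exp (-(t * x)))) Filter.atTop (nhds 0) := by
      have h1 : Filter.Tendsto (fun t : ℝ => Real.exp (-(t * x))) Filter.atTop (nhds 0) :=
        Real.tendsto_exp_neg_atTop_nhds_zero.comp (Filter.tendsto_id.atTop_mul_const hx)
      simpa using (h1.const_mul x⁻¹).neg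
    rw [lintegral_Ioi_of_hasDerivAt_of_nonneg hd (fun t _ => (Real.exp_pos _).le) hl]
    simp [ENNReal.ofReal_inv_of_pos hx]

/-- The antiderivative has exponent `-(k / c - 1)` and decays exactly because `c < k`. With `c = 1 +
α` this is where the rank condition of the theorem originates. -/
theorem lintegral_Ioi_rpow_linear {c k : ℝ} (hc : 0 < c) (hk : c < k) :
    ∫⁻ t in Set.Ioi (0 : ℝ), ENNReal.ofReal ((1 + c * t) ^ (-(k / c))) =
      ENNReal.ofReal (1 / (k - c)) := by
  have hkc : k - c ≠ 0 := by linarith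
  have hp : ∀ t ∈ Set.Ici (0 : ℝ), 0 < 1 + c * t := by
    intro t (ht : 0 ≤ t)
    positivity
  have hd : ∀ t ∈ Set.Ici (0 : ℝ),
      HasDerivAt (fun t => -((k - c)⁻¹ * (1 + c * t) ^ (-(k / c - 1))))
        ((1 + c * t) ^ (-(k / c))) t := by
    intro t ht
    have h1 : HasDerivAt (fun t : ℝ => 1 + c * t) (c * 1) t :=
      ((hasDerivAt_id t).const_mul c).const_add 1
    refine ((h1.rpow_const (p := -(k / c - 1)) (Or.inl (hp t ht).ne')).const_mul
      (k - c)⁻¹).fun_neg.congr_deriv ?_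
    rw [show -(k / c - 1) - 1 = -(k / c) by ring]
    field_simp
  have hl : Filter.Tendsto (fun t => -((k - c)⁻¹ * (1 + c * t) ^ (-(k / c - 1)))) Filter.atTop
      (nhds 0) := by
    have h0 : 0 < k / c - 1 := by
      rw [sub_pos, one_lt_div hc]
      exact hk
    have h1 : Filter.Tendsto (fun t : ℝ => (1 + c * t) ^ (-(k / c - 1))) Filter.atTop (nhds 0) :=
      (tendsto_rpow_neg_atTop h0).comp
        (Filter.tendsto_atTop_add_const_left _ 1 (Filter.tendsto_id.const_mul_atTop hc))
    simpa using (h1.const_mul (k - c)⁻¹).neg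
  rw [lintegral_Ioi_of_hasDerivAt_of_nonneg hd
    (fun t ht => Real.rpow_nonneg (hp t (Set.Ioi_subset_Ici_self ht)).le _) hl]
  simp

theorem lintegral_exp_neg_normSq_gaussianMatrix {𝕂 : Type*} [RCLike 𝕂] {m k : ℕ} {t : ℝ}
    (ht : 0 ≤ t) :
    ∫⁻ w, ENNReal.ofReal (Real.exp (-(t * ‖w‖ ^ 2))) ∂(gaussianMatrix 𝕂 m k) =
      ENNReal.ofReal ((1 + (1 + alpha 𝕂 : ℝ) * t) ^ (-((m * k : ℕ) / (1 + alpha 𝕂 : ℝ)))) := by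
  have hn : Measurable fun w : Matrix (Fin m) (Fin k) 𝕂 => ‖w‖ ^ 2 :=
    Measurable.frobenius_normSq measurable_id
  have hm : Measurable fun w : Matrix (Fin m) (Fin k) 𝕂 => Real.exp (-(t * ‖w‖ ^ 2)) := by
    fun_prop
  have hi : Integrable (fun w : Matrix (Fin m) (Fin k) 𝕂 => Real.exp (-(t * ‖w‖ ^ 2)))
      (gaussianMatrix 𝕂 m k) := by
    refine Integrable.of_bound hm.aestronglyMeasurable 1 (Filter.Eventually.of_forall fun w => ?_)
    rw [Real.norm_eq_abs, abs_of_pos (Real.exp_pos _), Real.exp_le_one_iff]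
    have : 0 ≤ t * ‖w‖ ^ 2 := by positivity
    linarith
  rw [← ofReal_integral_eq_lintegral_ofReal hi
    (Filter.Eventually.of_forall fun w => (Real.exp_pos _).le)]
  congr 1
  rw [gaussianMatrix, integral_map measurable_of_pairs.aemeasurable hm.aestronglyMeasurable]
  simp only [SketchSolve.frobenius_normSq, of_apply, Prod.mk.eta, Finset.mul_sum,
    ← Finset.sum_neg_distrib, Real.exp_sum]
  rw [integral_fintype_prod_eq_prod (fun (_ : Fin m × Fin k) (z : 𝕂) =>
    Real.exp (-(t * ‖z‖ ^ 2)))]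
  simp only [integral_exp_neg_normSq_stdNormal ht, Finset.prod_const, Finset.card_univ,
    Fintype.card_prod, Fintype.card_fin]
  rw [← Real.rpow_mul_natCast (by positivity)]
  congr 1
  ring

/-- The expected inverse squared norm of a Gaussian row. -/
theorem lintegral_inv_normSq_gaussianMatrix {𝕂 : Type*} [RCLike 𝕂] {k : ℕ}
    (hk : 1 + alpha 𝕂 < k) :
    ∫⁻ w, (ENNReal.ofReal (‖w‖ ^ 2))⁻¹ ∂(gaussianMatrix 𝕂 1 k) =
      ENNReal.ofReal (1 / ((k : ℝ) - (1 + alpha 𝕂))) := by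
  have hn : Measurable fun w : Matrix (Fin 1) (Fin k) 𝕂 => ‖w‖ ^ 2 :=
    Measurable.frobenius_normSq measurable_id
  -- By Tonelli, the mean of `1 / ‖w‖²` is the integral over `t` of the Laplace transform of `‖w‖²`,
  -- which is an explicit power.
  simp only [inv_ofReal_eq_lintegral_exp (sq_nonneg _)]
  rw [lintegral_lintegral_swap]
  · rw [← lintegral_Ioi_rpow_linear (by positivity) (by exact_mod_cast hk)]
    refine setLIntegral_congr_fun measurableSet_Ioi fun t ht => ?_
    simp only [lintegral_exp_neg_normSq_gaussianMatrix (le_of_lt ht), one_mul]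
  · have h2 : Measurable fun x : Matrix (Fin 1) (Fin k) 𝕂 × ℝ => ‖x.1‖ ^ 2 :=
      hn.comp measurable_fst
    unfold Function.uncurry
    fun_prop

/-- The squared Frobenius norm of the right inverse `Mᴴ (M Mᴴ)⁻¹`, infinite if `M` does not have
full row rank. -/
noncomputable def gramInvTrace {𝕂 : Type*} [RCLike 𝕂] {r l : ℕ}
    (M : Matrix (Fin r) (Fin l) 𝕂) : ENNReal :=
  open Classical in
  if (M * Mᴴ).det = 0 then ⊤ else ENNReal.ofReal (‖(M * Mᴴ)⁻¹ * M‖ ^ 2)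

/-- A diagonal entry of `(M Mᴴ)⁻¹`, infinite if `M` does not have full row rank. -/
noncomputable def gramInvDiag {𝕂 : Type*} [RCLike 𝕂] {r l : ℕ}
    (M : Matrix (Fin r) (Fin l) 𝕂) (i : Fin r) : ENNReal :=
  open Classical in
  if (M * Mᴴ).det = 0 then ⊤ else ENNReal.ofReal (RCLike.re ((M * Mᴴ)⁻¹ i i))

theorem measurable_gram {𝕂 : Type*} [RCLike 𝕂] {r l : ℕ} :
    Measurable fun M : Matrix (Fin r) (Fin l) 𝕂 => M * Mᴴ :=
  Measurable.matrix_mul measurable_id (Measurable.matrix_conjTranspose measurable_id)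

theorem measurableSet_gram_det {𝕂 : Type*} [RCLike 𝕂] {r l : ℕ} :
    MeasurableSet {M : Matrix (Fin r) (Fin l) 𝕂 | (M * Mᴴ).det = 0} :=
  (Measurable.matrix_det measurable_gram) (measurableSet_singleton 0)

theorem measurable_rowPinv {𝕂 : Type*} [RCLike 𝕂] {r l : ℕ} :
    Measurable fun M : Matrix (Fin r) (Fin l) 𝕂 => (M * Mᴴ)⁻¹ * M :=
  Measurable.matrix_mul (Measurable.matrix_inv measurable_gram) measurable_id

theorem measurable_gramInvTrace {𝕂 : Type*} [RCLike 𝕂] {r l : ℕ} :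
    Measurable (gramInvTrace : Matrix (Fin r) (Fin l) 𝕂 → ENNReal) :=
  Measurable.ite measurableSet_gram_det measurable_const
    (Measurable.frobenius_normSq measurable_rowPinv).ennreal_ofReal

theorem measurable_gramInvDiag {𝕂 : Type*} [RCLike 𝕂] {r l : ℕ} (i : Fin r) :
    Measurable fun M : Matrix (Fin r) (Fin l) 𝕂 => gramInvDiag M i :=
  Measurable.ite measurableSet_gram_det measurable_const
    (RCLike.measurable_re.comp
      (measurable_matrix_iff.mp (Measurable.matrix_inv measurable_gram) i i)).ennreal_ofReal

theorem rowPinv_mul_conjTranspose {𝕂 : Type*} [RCLike 𝕂] {r l : ℕ}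
    {M : Matrix (Fin r) (Fin l) 𝕂} (h : (M * Mᴴ).det ≠ 0) :
    ((M * Mᴴ)⁻¹ * M) * ((M * Mᴴ)⁻¹ * M)ᴴ = (M * Mᴴ)⁻¹ := by
  rw [conjTranspose_mul, inv_isHermitian (by simp), Matrix.mul_assoc, ← Matrix.mul_assoc M,
    mul_nonsing_inv _ (isUnit_iff_ne_zero.mpr h), Matrix.mul_one]

/-- The rows of `(M Mᴴ)⁻¹ M` have Gram matrix `(M Mᴴ)⁻¹`, so its diagonal lists their squared norms.
-/
theorem gramInvTrace_eq_sum {𝕂 : Type*} [RCLike 𝕂] {r l : ℕ}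
    {M : Matrix (Fin r) (Fin l) 𝕂} (h : (M * Mᴴ).det ≠ 0) :
    gramInvTrace M = ∑ i, gramInvDiag M i := by
  have e : ∀ i, RCLike.re ((M * Mᴴ)⁻¹ i i) = ∑ j, ‖((M * Mᴴ)⁻¹ * M) i j‖ ^ 2 := by
    intro i
    conv_lhs => rw [← rowPinv_mul_conjTranspose h, mul_apply]
    simp only [conjTranspose_apply, map_sum, RCLike.star_def, RCLike.mul_conj]
    simp only [← RCLike.ofReal_pow, RCLike.ofReal_re]
  simp only [gramInvTrace, gramInvDiag, h, if_false, e, frobenius_normSq, Fintype.sum_prod_type]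
  exact ENNReal.ofReal_sum_of_nonneg fun i _ => Finset.sum_nonneg fun j _ => by positivity

theorem exists_isometry_of_gram_det_ne_zero {𝕂 : Type*} [RCLike 𝕂] {r l : ℕ}
    {N : Matrix (Fin r) (Fin l) 𝕂} (h : (N * Nᴴ).det ≠ 0) :
    ∃ (Q : Matrix (Fin l) (Fin r) 𝕂) (T : Matrix (Fin r) (Fin r) 𝕂),
      Qᴴ * Q = 1 ∧ Nᴴ = Q * T ∧ IsUnit T.det := by
  have hr : Nᴴ.rank = r := by
    open scoped ComplexOrder in
    rw [rank_conjTranspose, ← rank_self_mul_conjTranspose,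
      rank_of_isUnit _ ((isUnit_iff_isUnit_det _).mpr (isUnit_iff_ne_zero.mpr h))]
    simp
  obtain ⟨Q, T, hQ, hN, hT⟩ := exists_isometry_mul Nᴴ hr
  rw [det_mul] at hT
  exact ⟨Q, T, hQ, hN, isUnit_of_mul_isUnit_left hT⟩

/-- The Schur complement formula for a diagonal entry of the inverse of a Gram matrix. -/
theorem gramInvDiag_add {𝕂 : Type*} [RCLike 𝕂] {r l k : ℕ}
    {N : Matrix (Fin r) (Fin l) 𝕂} {Q : Matrix (Fin l) (Fin r) 𝕂} {T : Matrix (Fin r) (Fin r) 𝕂}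
    {Q' : Matrix (Fin l) (Fin k) 𝕂} (hN : Nᴴ = Q * T) (hT : IsUnit T.det)
    (hQQ' : Qᴴ * Q' = 0) (hQ : Q * Qᴴ + Q' * Q'ᴴ = 1) (hdet : (N * Nᴴ).det ≠ 0)
    {i : Fin (r + 1)} {e : Matrix (Fin (r + 1)) (Fin 1) 𝕂} (hei : e = Matrix.single i 0 1)
    {P : Matrix (Fin (r + 1)) (Fin r) 𝕂} (hP : Pᴴ * P = 1)
    (heP : eᴴ * P = 0) (hPe : P * Pᴴ + e * eᴴ = 1) (a : Matrix (Fin 1) (Fin l) 𝕂) :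
    gramInvDiag (P * N + e * a) i = (ENNReal.ofReal (‖a * Q'‖ ^ 2))⁻¹ := by
  have he : eᴴ * e = 1 := by
    rw [hei]
    ext u v
    rw [Subsingleton.elim u 0, Subsingleton.elim v 0]
    simp
  have hPe0 : Pᴴ * e = 0 := by
    rw [← conjTranspose_conjTranspose e, ← conjTranspose_mul, heP, conjTranspose_zero]
  set M := P * N + e * a with hM
  set c : ℝ := ‖a * Q'‖ ^ 2 with hc
  -- `y` is the part of `aᴴ` orthogonal to the range of `Nᴴ`, and `x` is chosen so that `Mᴴ * x =
  -- y`. Then `M * Mᴴ * x = c • e` and `eᴴ * x = 1`, so `c` times the diagonal entry is one.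
  set y := Q' * (Q'ᴴ * aᴴ) with hy
  set x := e - P * (T⁻¹ * (Qᴴ * aᴴ)) with hx
  have hMH : Mᴴ = Nᴴ * Pᴴ + aᴴ * eᴴ := by
    rw [hM, conjTranspose_add, conjTranspose_mul, conjTranspose_mul]
  have hMx : Mᴴ * x = y := by
    have h1 : Mᴴ * e = aᴴ := by
      rw [hMH, Matrix.add_mul, Matrix.mul_assoc, Matrix.mul_assoc, hPe0, he]
      simp
    have h2 : Mᴴ * P = Q * T := by
      rw [hMH, Matrix.add_mul, Matrix.mul_assoc, Matrix.mul_assoc, heP, hP, hN]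
      simp
    rw [hx, Matrix.mul_sub, h1, ← Matrix.mul_assoc, h2, Matrix.mul_assoc, ← Matrix.mul_assoc T,
      mul_nonsing_inv _ hT, Matrix.one_mul, hy, sub_eq_iff_eq_add', ← Matrix.mul_assoc,
      ← Matrix.mul_assoc, ← Matrix.add_mul, hQ, Matrix.one_mul]
  have hNQ' : N * Q' = 0 := by
    rw [← conjTranspose_conjTranspose N, hN, conjTranspose_mul, Matrix.mul_assoc, hQQ',
      Matrix.mul_zero]
  have hay : a * y = (c : 𝕂) • (1 : Matrix (Fin 1) (Fin 1) 𝕂) := by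
    have h1 : a * y = (a * Q') * (a * Q')ᴴ := by
      rw [hy, conjTranspose_mul, ← Matrix.mul_assoc]
    rw [h1]
    ext u v
    rw [Subsingleton.elim u 0, Subsingleton.elim v 0, hc, frobenius_normSq, mul_apply]
    simp [conjTranspose_apply, RCLike.mul_conj, Fintype.sum_prod_type]
  have hMy : M * y = (c : 𝕂) • e := by
    rw [hM, Matrix.add_mul, Matrix.mul_assoc, Matrix.mul_assoc, hay, hy, ← Matrix.mul_assoc N,
      hNQ']
    simp
  have hgram : M * Mᴴ * x = (c : 𝕂) • e := by rw [Matrix.mul_assoc, hMx, hMy]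
  have hex : eᴴ * x = 1 := by
    rw [hx, Matrix.mul_sub, he, ← Matrix.mul_assoc, heP]
    simp
  have hent : ∀ X : Matrix (Fin (r + 1)) (Fin (r + 1)) 𝕂, (eᴴ * (X * e)) 0 0 = X i i := by
    intro X
    rw [hei]
    simp [mul_apply, Matrix.single_apply]
  by_cases hd : (M * Mᴴ).det = 0
  -- In the singular case both sides must be infinite. A kernel vector `V` satisfies `Mᴴ * V = 0`;
  -- pairing this with `y` gives `c • (eᴴ * V) = 0`, and if `c ≠ 0` the full rank of `N` forces `V =
  -- 0`.
  · have hc0 : c = 0 := by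
      by_contra hc0
      obtain ⟨v, hv, hMv⟩ := exists_mulVec_eq_zero_iff.mpr hd
      apply hv
      set V := replicateCol (Fin 1) v with hV
      have h1 : M * Mᴴ * V = 0 := by
        rw [hV, ← replicateCol_mulVec, hMv, replicateCol_zero]
      have h2 : Nᴴ * (Pᴴ * V) + aᴴ * (eᴴ * V) = 0 := by
        open scoped ComplexOrder in
        rw [self_mul_conjTranspose_mul_eq_zero, hMH, Matrix.add_mul, Matrix.mul_assoc,
          Matrix.mul_assoc] at h1
        exact h1
      have h3 : eᴴ * V = 0 := by
        have h5 : yᴴ * Nᴴ = 0 := by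
          rw [← conjTranspose_mul, hy, ← Matrix.mul_assoc N, hNQ', Matrix.zero_mul,
            conjTranspose_zero]
        have h6 : yᴴ * aᴴ = (c : 𝕂) • (1 : Matrix (Fin 1) (Fin 1) 𝕂) := by
          rw [← conjTranspose_mul, hay, conjTranspose_smul]
          simp
        have h7 := congrArg (fun Z => yᴴ * Z) h2
        simp only [Matrix.mul_add, Matrix.mul_zero] at h7
        rw [← Matrix.mul_assoc, h5, Matrix.zero_mul, zero_add, ← Matrix.mul_assoc, h6,
          Matrix.smul_mul, Matrix.one_mul, smul_eq_zero] at h7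
        exact h7.resolve_left (by exact_mod_cast hc0)
      have h4 : Pᴴ * V = 0 := by
        rw [h3, Matrix.mul_zero, add_zero] at h2
        have h5 : N * Nᴴ * (Pᴴ * V) = 0 := by rw [Matrix.mul_assoc, h2, Matrix.mul_zero]
        have h6 := congrArg (fun Z => (N * Nᴴ)⁻¹ * Z) h5
        simp only [Matrix.mul_zero] at h6
        rwa [← Matrix.mul_assoc, nonsing_inv_mul _ (isUnit_iff_ne_zero.mpr hdet),
          Matrix.one_mul] at h6
      have h5 : V = 0 := by
        rw [← Matrix.one_mul V, ← hPe, Matrix.add_mul, Matrix.mul_assoc, Matrix.mul_assoc, h3, h4]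
        simp
      ext j
      exact congrFun (congrFun h5 j) 0
    simp [gramInvDiag, hd, hc0]
  · have h1 : x = (c : 𝕂) • ((M * Mᴴ)⁻¹ * e) := by
      rw [← Matrix.mul_smul, ← hgram, ← Matrix.mul_assoc,
        nonsing_inv_mul _ (isUnit_iff_ne_zero.mpr hd), Matrix.one_mul]
    have h2 : (c : 𝕂) * (M * Mᴴ)⁻¹ i i = 1 := by
      rw [← hent (M * Mᴴ)⁻¹, ← smul_eq_mul, ← Matrix.smul_apply, ← Matrix.mul_smul, ← h1, hex]
      simp
    have h3 : c * RCLike.re ((M * Mᴴ)⁻¹ i i) = 1 := by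
      rw [← RCLike.re_ofReal_mul, h2, RCLike.one_re]
    have hc0 : c ≠ 0 := fun h => by simp [h] at h3
    have hcpos : 0 < c := lt_of_le_of_ne (by positivity) hc0.symm
    rw [gramInvDiag, if_neg hd, ← ENNReal.ofReal_inv_of_pos hcpos]
    congr 1
    field_simp
    linarith

/-- Split off row `i`. Given the other `r` rows, the entry is the inverse squared norm of the
projection of row `i` onto their orthogonal complement, a Gaussian row of length `l - r`. -/
theorem lintegral_gramInvDiag_gaussianMatrix {𝕂 : Type*} [RCLike 𝕂] {r l : ℕ}
    (h : r + 1 + alpha 𝕂 < l)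
    (hdet : ∀ᵐ N ∂(gaussianMatrix 𝕂 r l), (N * Nᴴ).det ≠ 0) (i : Fin (r + 1)) :
    ∫⁻ M, gramInvDiag M i ∂(gaussianMatrix 𝕂 (r + 1) l) =
      ENNReal.ofReal (1 / ((l : ℝ) - (r + 1 : ℕ) - alpha 𝕂)) := by
  obtain ⟨k, hk⟩ := Nat.exists_eq_add_of_le (show r ≤ l by omega)
  set e : Matrix (Fin (r + 1)) (Fin 1) 𝕂 := Matrix.single i 0 1 with hei
  have he : eᴴ * e = 1 := by
    rw [hei]
    ext u v
    rw [Subsingleton.elim u 0, Subsingleton.elim v 0]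
    simp
  obtain ⟨P, hP, heP, hPe⟩ := exists_orthogonal_complement (k := r) (by simp [add_comm]) e he
  replace hPe : P * Pᴴ + e * eᴴ = 1 := (add_comm _ _).trans hPe
  rw [← gaussianMatrix_prod_map_mul_left hPe, lintegral_map (measurable_gramInvDiag i)
    (Measurable.matrix_add (Measurable.matrix_mul measurable_const measurable_fst)
      (Measurable.matrix_mul measurable_const measurable_snd)),
    lintegral_prod]
  · have key : ∀ᵐ N ∂(gaussianMatrix 𝕂 r l),
        ∫⁻ a, gramInvDiag (P * N + e * a) i ∂(gaussianMatrix 𝕂 1 l) =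
          ENNReal.ofReal (1 / ((l : ℝ) - (r + 1 : ℕ) - alpha 𝕂)) := by
      filter_upwards [hdet] with N hN
      obtain ⟨Q, T, hQ, hNQ, hT⟩ := exists_isometry_of_gram_det_ne_zero hN
      obtain ⟨Q', hQ', hQQ', hsum⟩ := exists_orthogonal_complement (k := k) (by simp [hk]) Q hQ
      simp only [gramInvDiag_add hNQ hT hQQ' hsum hN hei hP heP hPe]
      have hm : Measurable fun w : Matrix (Fin 1) (Fin k) 𝕂 => (ENNReal.ofReal (‖w‖ ^ 2))⁻¹ :=
        (Measurable.frobenius_normSq measurable_id).ennreal_ofReal.inv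
      have hmap := lintegral_map (μ := gaussianMatrix 𝕂 1 l) hm
        (g := fun a => a * Q') (Measurable.matrix_mul measurable_id measurable_const)
      rw [← hmap, gaussianMatrix_map_mul_right hQ',
        lintegral_inv_normSq_gaussianMatrix (by omega), hk]
      congr 2
      push_cast
      ring
    rw [lintegral_congr_ae key]
    simp
  · exact ((measurable_gramInvDiag i).comp
      (Measurable.matrix_add (Measurable.matrix_mul measurable_const measurable_fst)
      (Measurable.matrix_mul measurable_const measurable_snd))).aemeasurable

/-- `gramInvDiag` is `⊤` on singular Gram matrices, so its finite mean excludes them almost surely.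
The mean for `r + 1` rows needs only full rank for `r` rows, which makes the induction work. -/
theorem ae_gram_det_ne_zero_gaussianMatrix {𝕂 : Type*} [RCLike 𝕂] {r l : ℕ}
    (h : r + alpha 𝕂 < l) : ∀ᵐ N ∂(gaussianMatrix 𝕂 r l), (N * Nᴴ).det ≠ 0 := by
  induction r with
  | zero => simp
  | succ r ih =>
    have h1 := lintegral_gramInvDiag_gaussianMatrix h (ih (by omega)) 0
    have h2 := ae_lt_top (measurable_gramInvDiag (0 : Fin (r + 1)))
      (by rw [h1]; exact ENNReal.ofReal_ne_top)
    filter_upwards [h2] with N hN hd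
    simp [gramInvDiag, hd] at hN

/-- The expected trace of the inverse of a Gaussian Gram matrix. -/
theorem lintegral_gramInvTrace_gaussianMatrix {𝕂 : Type*} [RCLike 𝕂] {r l : ℕ}
    (h : r + alpha 𝕂 < l) :
    ∫⁻ M, gramInvTrace M ∂(gaussianMatrix 𝕂 r l) =
      ENNReal.ofReal (r / ((l : ℝ) - r - alpha 𝕂)) := by
  have h1 : ∫⁻ M, gramInvTrace M ∂(gaussianMatrix 𝕂 r l) =
      ∫⁻ M, ∑ i, gramInvDiag M i ∂(gaussianMatrix 𝕂 r l) := by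
    refine lintegral_congr_ae ?_
    filter_upwards [ae_gram_det_ne_zero_gaussianMatrix h] with M hM
    exact gramInvTrace_eq_sum hM
  rw [h1, lintegral_finsetSum _ fun i _ => measurable_gramInvDiag i]
  cases r with
  | zero => simp
  | succ r =>
    simp only [lintegral_gramInvDiag_gaussianMatrix h
      (ae_gram_det_ne_zero_gaussianMatrix (by omega))]
    rw [Finset.sum_const, Finset.card_univ, Fintype.card_fin, ← ENNReal.ofReal_nsmul]
    congr 1
    rw [nsmul_eq_mul]
    ring

/-! ### Frobenius norms and isometries -/

theorem normSq_add_of_conjTranspose_mul_eq_zero {𝕂 : Type*} [RCLike 𝕂] {ι κ : Type*} [Fintype ι]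
    [Fintype κ] {X Y : Matrix ι κ 𝕂} (h : Xᴴ * Y = 0) : ‖X + Y‖ ^ 2 = ‖X‖ ^ 2 + ‖Y‖ ^ 2 := by
  have h' : Yᴴ * X = 0 := by
    rw [← conjTranspose_conjTranspose X, ← conjTranspose_mul, h, conjTranspose_zero]
  simp only [frobenius_normSq_eq_re_trace, conjTranspose_add, Matrix.add_mul, Matrix.mul_add, h,
    h', add_zero, zero_add, trace_add, map_add]

theorem normSq_isometry_mul {𝕂 : Type*} [RCLike 𝕂] {ι κ o : Type*} [Fintype ι]
    [Fintype κ] [Fintype o] [DecidableEq κ] {Q : Matrix ι κ 𝕂} (hQ : Qᴴ * Q = 1)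
    (X : Matrix κ o 𝕂) : ‖Q * X‖ ^ 2 = ‖X‖ ^ 2 := by
  rw [frobenius_normSq_eq_re_trace, frobenius_normSq_eq_re_trace, conjTranspose_mul,
    Matrix.mul_assoc, ← Matrix.mul_assoc Qᴴ, hQ, Matrix.one_mul]

theorem normSq_mul_isometry_conjTranspose {𝕂 : Type*} [RCLike 𝕂] {ι κ o : Type*} [Fintype ι]
    [Fintype κ] [Fintype o] [DecidableEq κ] {Q : Matrix ι κ 𝕂} (hQ : Qᴴ * Q = 1)
    (X : Matrix o κ 𝕂) : ‖X * Qᴴ‖ ^ 2 = ‖X‖ ^ 2 := by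
  rw [← frobenius_norm_conjTranspose, conjTranspose_mul, conjTranspose_conjTranspose,
    normSq_isometry_mul hQ, frobenius_norm_conjTranspose]

theorem normSq_mul_isometry_conjTranspose_add {𝕂 : Type*} [RCLike 𝕂] {ι κ κ' o : Type*}
    [Fintype ι] [Fintype κ] [Fintype κ'] [Fintype o] [DecidableEq κ] [DecidableEq κ']
    {Q : Matrix ι κ 𝕂} {Q' : Matrix ι κ' 𝕂} (hQ : Qᴴ * Q = 1) (hQ' : Q'ᴴ * Q' = 1)
    (hQQ' : Qᴴ * Q' = 0) (X : Matrix o κ 𝕂) (Y : Matrix o κ' 𝕂) :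
    ‖X * Qᴴ + Y * Q'ᴴ‖ ^ 2 = ‖X‖ ^ 2 + ‖Y‖ ^ 2 := by
  rw [← frobenius_norm_conjTranspose, conjTranspose_add, conjTranspose_mul, conjTranspose_mul,
    conjTranspose_conjTranspose, conjTranspose_conjTranspose,
    normSq_add_of_conjTranspose_mul_eq_zero, normSq_isometry_mul hQ, normSq_isometry_mul hQ',
    frobenius_norm_conjTranspose, frobenius_norm_conjTranspose]
  rw [conjTranspose_mul, conjTranspose_conjTranspose, Matrix.mul_assoc, ← Matrix.mul_assoc Qᴴ,
    hQQ', Matrix.zero_mul, Matrix.mul_zero]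

theorem normSq_one {𝕂 : Type*} [RCLike 𝕂] {r : ℕ} :
    ‖(1 : Matrix (Fin r) (Fin r) 𝕂)‖ ^ 2 = r := by
  rw [frobenius_normSq_eq_re_trace]
  simp

theorem rowPinv_mul_conjTranspose_self {𝕂 : Type*} [RCLike 𝕂] {r l : ℕ}
    {N : Matrix (Fin r) (Fin l) 𝕂} (h : (N * Nᴴ).det ≠ 0) : (N * Nᴴ)⁻¹ * N * Nᴴ = 1 := by
  rw [Matrix.mul_assoc, nonsing_inv_mul _ (isUnit_iff_ne_zero.mpr h)]

/-- The matrix inside the norm is an orthogonal projection of rank `r`, and its squared norm is its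
trace. -/
theorem normSq_rowPinv_conjTranspose_mul {𝕂 : Type*} [RCLike 𝕂] {r l : ℕ}
    {N : Matrix (Fin r) (Fin l) 𝕂} (h : (N * Nᴴ).det ≠ 0) :
    ‖((N * Nᴴ)⁻¹ * N)ᴴ * N‖ ^ 2 = r := by
  rw [frobenius_normSq_eq_re_trace, conjTranspose_mul, conjTranspose_conjTranspose,
    trace_mul_comm]
  have : ((N * Nᴴ)⁻¹ * N)ᴴ * N * (Nᴴ * ((N * Nᴴ)⁻¹ * N)) = ((N * Nᴴ)⁻¹ * N)ᴴ * N := by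
    rw [Matrix.mul_assoc, ← Matrix.mul_assoc N, ← Matrix.mul_assoc (N * Nᴴ),
      mul_nonsing_inv _ (isUnit_iff_ne_zero.mpr h), Matrix.one_mul]
  rw [this, trace_mul_comm, conjTranspose_mul, inv_isHermitian (by simp), ← Matrix.mul_assoc,
    mul_nonsing_inv _ (isUnit_iff_ne_zero.mpr h)]
  simp

/-! ### Rotation invariance -/

/-- `IdentDistrib` carries almost everywhere measurability; the identity rotation extracts it. -/
theorem IsRotationInvariant.aemeasurable {𝕂 : Type*} [RCLike 𝕂] {S : Type*} [MeasurableSpace S]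
    {μ : Measure S} {n l : ℕ} {Ω : S → Matrix (Fin n) (Fin l) 𝕂} (h : IsRotationInvariant Ω μ) :
    AEMeasurable Ω μ :=
  (h 1 (one_mem _)).aemeasurable_snd

theorem IsRotationInvariant.lintegral_eq {𝕂 : Type*} [RCLike 𝕂] {S : Type*} [MeasurableSpace S]
    {μ : Measure S} {n l : ℕ} {Ω : S → Matrix (Fin n) (Fin l) 𝕂} (h : IsRotationInvariant Ω μ)
    {U : Matrix (Fin n) (Fin n) 𝕂} (hU : U ∈ Matrix.unitaryGroup (Fin n) 𝕂)
    {F : Matrix (Fin n) (Fin l) 𝕂 → ENNReal} (hF : Measurable F) :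
    ∫⁻ ω, F (Uᴴ * Ω ω) ∂μ = ∫⁻ ω, F (Ω ω) ∂μ :=
  ((h Uᴴ (Unitary.star_mem hU)).comp hF).lintegral_eq

theorem IsGaussian.isRotationInvariant {𝕂 : Type*} [RCLike 𝕂] {S : Type*} [MeasurableSpace S]
    {μ : Measure S} [IsProbabilityMeasure μ] {n l : ℕ} {Ω : S → Matrix (Fin n) (Fin l) 𝕂}
    (h : IsGaussian Ω μ) : IsRotationInvariant Ω μ := by
  intro U hU
  have hm : Measurable fun M : Matrix (Fin n) (Fin l) 𝕂 => U * M :=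
    Measurable.matrix_mul measurable_const measurable_id
  refine ⟨hm.comp_aemeasurable h.aemeasurable, h.aemeasurable, ?_⟩
  have h1 := AEMeasurable.map_map_of_aemeasurable hm.aemeasurable h.aemeasurable
  rw [h.map_eq, gaussianMatrix_map_mul_left (mem_unitaryGroup_iff.mp hU)] at h1
  rw [h.map_eq]
  exact h1.symm

/-- The unitary that carries `Q` to `R` is absorbed by the law of `Ω`. -/
theorem IsRotationInvariant.lintegral_isometry_eq {𝕂 : Type*} [RCLike 𝕂] {S : Type*}
    [MeasurableSpace S] {μ : Measure S} {n l r : ℕ} {Ω : S → Matrix (Fin n) (Fin l) 𝕂}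
    (h : IsRotationInvariant Ω μ) (hr : r ≤ n) {Q R : Matrix (Fin n) (Fin r) 𝕂}
    (hQ : Qᴴ * Q = 1) (hR : Rᴴ * R = 1) {F : Matrix (Fin r) (Fin l) 𝕂 → ENNReal}
    (hF : Measurable F) : ∫⁻ ω, F (Rᴴ * Ω ω) ∂μ = ∫⁻ ω, F (Qᴴ * Ω ω) ∂μ := by
  obtain ⟨U, hU, rfl⟩ := exists_unitary_mul_eq (by simpa using hr) hQ hR
  simp only [conjTranspose_mul, Matrix.mul_assoc]
  exact h.lintegral_eq hU
    (F := fun M => F (Qᴴ * M)) (hF.comp (Measurable.matrix_mul measurable_const measurable_id))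

/-! ### The expected inverse Gram matrix of a random orthonormal matrix -/

/-- The squared Frobenius norm of `(H M)⁺ H`, infinite if `H M` does not have full row rank. -/
noncomputable def relGramInvTrace {𝕂 : Type*} [RCLike 𝕂] {r n l : ℕ}
    (H : Matrix (Fin r) (Fin n) 𝕂) (M : Matrix (Fin n) (Fin l) 𝕂) : ENNReal :=
  open Classical in
  if (H * M * (H * M)ᴴ).det = 0 then ⊤
  else ENNReal.ofReal (‖((H * M * (H * M)ᴴ)⁻¹ * (H * M))ᴴ * H‖ ^ 2)

theorem measurable_relGramInvTrace {𝕂 : Type*} [RCLike 𝕂] {r n l : ℕ} :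
    Measurable fun x : Matrix (Fin r) (Fin n) 𝕂 × Matrix (Fin n) (Fin l) 𝕂 =>
      relGramInvTrace x.1 x.2 := by
  have hHM : Measurable fun x : Matrix (Fin r) (Fin n) 𝕂 × Matrix (Fin n) (Fin l) 𝕂 =>
      x.1 * x.2 := Measurable.matrix_mul measurable_fst measurable_snd
  exact Measurable.ite (hHM measurableSet_gram_det) measurable_const
    (Measurable.frobenius_normSq (Measurable.matrix_mul
      (Measurable.matrix_conjTranspose (measurable_rowPinv.comp hHM))
      measurable_fst)).ennreal_ofReal

/-- The invertible factor `T` cancels in `(H M)⁺ H`, so only the row space of `H` matters. -/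
theorem relGramInvTrace_mul_isometry {𝕂 : Type*} [RCLike 𝕂] {r n l : ℕ}
    {H : Matrix (Fin r) (Fin n) 𝕂} {Q : Matrix (Fin n) (Fin r) 𝕂} {T : Matrix (Fin r) (Fin r) 𝕂}
    (hQ : Qᴴ * Q = 1) (hH : Hᴴ = Q * T) (hT : IsUnit T.det) (M : Matrix (Fin n) (Fin l) 𝕂) :
    relGramInvTrace H M = gramInvTrace (Qᴴ * M) := by
  have hH' : H = Tᴴ * Qᴴ := by rw [← conjTranspose_mul, ← hH, conjTranspose_conjTranspose]
  have hT' : IsUnit (Tᴴ).det := by rw [det_conjTranspose]; exact hT.star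
  have hgram : H * M * (H * M)ᴴ = Tᴴ * (Qᴴ * M * (Qᴴ * M)ᴴ) * T := by
    rw [hH']
    simp only [conjTranspose_mul, conjTranspose_conjTranspose, Matrix.mul_assoc]
  have hdet : (H * M * (H * M)ᴴ).det = 0 ↔ (Qᴴ * M * (Qᴴ * M)ᴴ).det = 0 := by
    rw [hgram, det_mul, det_mul]
    simp [hT.ne_zero]
  have hS : ((H * M * (H * M)ᴴ)⁻¹ * (H * M))ᴴ * H =
      ((Qᴴ * M * (Qᴴ * M)ᴴ)⁻¹ * (Qᴴ * M))ᴴ * Qᴴ := by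
    have h1 : (H * M * (H * M)ᴴ)⁻¹ * (H * M) =
        T⁻¹ * ((Qᴴ * M * (Qᴴ * M)ᴴ)⁻¹ * (Qᴴ * M)) := by
      rw [hgram, Matrix.mul_inv_rev, Matrix.mul_inv_rev, hH']
      simp only [Matrix.mul_assoc]
      rw [← Matrix.mul_assoc (Tᴴ)⁻¹ Tᴴ, nonsing_inv_mul _ hT', Matrix.one_mul]
    rw [h1, conjTranspose_mul, conjTranspose_nonsing_inv, Matrix.mul_assoc]
    congr 1
    rw [hH', ← Matrix.mul_assoc, nonsing_inv_mul _ hT', Matrix.one_mul]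
  unfold relGramInvTrace gramInvTrace
  simp only [hdet]
  rw [hS, normSq_mul_isometry_conjTranspose hQ, frobenius_norm_conjTranspose]

/-- With `[M M']` unitary, `H = N Mᴴ + W M'ᴴ` for independent Gaussian `N` and `W`, and `H M = N`.
Thus `(H M)⁺ H = N⁺ N Mᴴ + N⁺ W M'ᴴ`: the first piece is a projection of squared norm `r`, the
second averages over `W` to `(n - l) ‖N⁺‖²`. -/
theorem lintegral_relGramInvTrace_gaussianMatrix {𝕂 : Type*} [RCLike 𝕂] {r n l : ℕ}
    (h : r + alpha 𝕂 < l) {M : Matrix (Fin n) (Fin l) 𝕂} (hM : Mᴴ * M = 1) (hln : l ≤ n) :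
    ∫⁻ H, relGramInvTrace H M ∂(gaussianMatrix 𝕂 r n) =
      r + ENNReal.ofReal ((n : ℝ) - l) * ENNReal.ofReal (r / ((l : ℝ) - r - alpha 𝕂)) := by
  obtain ⟨k, hk⟩ := Nat.exists_eq_add_of_le hln
  obtain ⟨M', hM', hMM', hsum⟩ := exists_orthogonal_complement (k := k) (by simp [hk]) M hM
  have hM'M : M'ᴴ * M = 0 := by
    rw [← conjTranspose_conjTranspose M, ← conjTranspose_mul, hMM', conjTranspose_zero]
  have hf : Measurable fun x : Matrix (Fin r) (Fin l) 𝕂 × Matrix (Fin r) (Fin k) 𝕂 =>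
      x.1 * Mᴴ + x.2 * M'ᴴ :=
    Measurable.matrix_add (Measurable.matrix_mul measurable_fst measurable_const)
      (Measurable.matrix_mul measurable_snd measurable_const)
  have hm : Measurable fun H : Matrix (Fin r) (Fin n) 𝕂 => relGramInvTrace H M :=
    Measurable.of_uncurry_right (f := fun H M => relGramInvTrace H M) measurable_relGramInvTrace
  have hfubini : ∫⁻ H, relGramInvTrace H M ∂(gaussianMatrix 𝕂 r n) =
      ∫⁻ N, ∫⁻ W, relGramInvTrace (N * Mᴴ + W * M'ᴴ) M ∂(gaussianMatrix 𝕂 r k)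
        ∂(gaussianMatrix 𝕂 r l) := by
    have h1 := lintegral_map (μ := (gaussianMatrix 𝕂 r l).prod (gaussianMatrix 𝕂 r k)) hm hf
    rw [gaussianMatrix_prod_map_mul_right hsum] at h1
    rw [h1]
    exact lintegral_prod _ (hm.comp hf).aemeasurable
  have key : ∀ᵐ N ∂(gaussianMatrix 𝕂 r l),
      ∫⁻ W, relGramInvTrace (N * Mᴴ + W * M'ᴴ) M ∂(gaussianMatrix 𝕂 r k) =
        r + ENNReal.ofReal ((n : ℝ) - l) * gramInvTrace N := by
    filter_upwards [ae_gram_det_ne_zero_gaussianMatrix h] with N hN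
    have hHM : ∀ W : Matrix (Fin r) (Fin k) 𝕂, (N * Mᴴ + W * M'ᴴ) * M = N := by
      intro W
      rw [Matrix.add_mul, Matrix.mul_assoc, Matrix.mul_assoc, hM, hM'M]
      simp
    -- The identity factor on the right has squared norm `k = n - l`, the source of that constant.
    have e : ∀ W : Matrix (Fin r) (Fin k) 𝕂, relGramInvTrace (N * Mᴴ + W * M'ᴴ) M =
        r + ENNReal.ofReal (‖((N * Nᴴ)⁻¹ * N)ᴴ * W *
          (1 : Matrix (Fin k) (Fin k) 𝕂)‖ ^ 2) := by
      intro W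
      rw [relGramInvTrace, hHM, if_neg hN, Matrix.mul_add, ← Matrix.mul_assoc,
        ← Matrix.mul_assoc, normSq_mul_isometry_conjTranspose_add hM hM' hMM',
        normSq_rowPinv_conjTranspose_mul hN, ENNReal.ofReal_add (by positivity) (by positivity),
        Matrix.mul_one, ENNReal.ofReal_natCast]
    simp only [e]
    rw [lintegral_add_left measurable_const, lintegral_normSq_mul_mul_gaussianMatrix,
      gramInvTrace, if_neg hN, normSq_one, frobenius_norm_conjTranspose, mul_comm,
      ENNReal.ofReal_mul (by positivity), hk]
    simp
  rw [hfubini, lintegral_congr_ae key, lintegral_add_left measurable_const,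
    lintegral_const_mul _ measurable_gramInvTrace, lintegral_gramInvTrace_gaussianMatrix h]
  simp

/-- Integrate `relGramInvTrace H M` over an auxiliary Gaussian `H` and the law of `Ω`, in both
orders. For fixed `H` of full row rank, invariance replaces the row space of `H` by the range of
`Q`; for fixed `M` the Gaussian computation applies. -/
theorem IsRandomOrthonormal.lintegral_gramInvTrace {𝕂 : Type*} [RCLike 𝕂] {S : Type*}
    [MeasurableSpace S] {μ : Measure S} [IsProbabilityMeasure μ] {n l r : ℕ}
    {Ω : S → Matrix (Fin n) (Fin l) 𝕂} (hΩ : IsRandomOrthonormal Ω μ) (hln : l ≤ n)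
    (h : r + alpha 𝕂 < l) {Q : Matrix (Fin n) (Fin r) 𝕂} (hQ : Qᴴ * Q = 1) :
    ∫⁻ ω, gramInvTrace (Qᴴ * Ω ω) ∂μ =
      r + ENNReal.ofReal ((n : ℝ) - l) * ENNReal.ofReal (r / ((l : ℝ) - r - alpha 𝕂)) := by
  have hae := hΩ.rotationInvariant.aemeasurable
  have hprob : IsProbabilityMeasure (μ.map Ω) := Measure.isProbabilityMeasure_map hae
  have h1 : ∫⁻ H, ∫⁻ M, relGramInvTrace H M ∂(μ.map Ω) ∂(gaussianMatrix 𝕂 r n) =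
      ∫⁻ ω, gramInvTrace (Qᴴ * Ω ω) ∂μ := by
    have key : ∀ᵐ H ∂(gaussianMatrix 𝕂 r n), ∫⁻ M, relGramInvTrace H M ∂(μ.map Ω) =
        ∫⁻ ω, gramInvTrace (Qᴴ * Ω ω) ∂μ := by
      filter_upwards [ae_gram_det_ne_zero_gaussianMatrix (𝕂 := 𝕂) (h.trans_le hln)] with H hH
      obtain ⟨R, T, hR, hHR, hT⟩ := exists_isometry_of_gram_det_ne_zero hH
      simp only [relGramInvTrace_mul_isometry hR hHR hT]
      have hm : Measurable fun M : Matrix (Fin n) (Fin l) 𝕂 => gramInvTrace (Rᴴ * M) :=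
        measurable_gramInvTrace.comp (Measurable.matrix_mul measurable_const measurable_id)
      rw [lintegral_map' hm.aemeasurable hae]
      exact hΩ.rotationInvariant.lintegral_isometry_eq (by omega) hQ hR measurable_gramInvTrace
    rw [lintegral_congr_ae key]
    simp
  rw [← h1, lintegral_lintegral_swap measurable_relGramInvTrace.aemeasurable]
  have key : ∀ᵐ M ∂(μ.map Ω), ∫⁻ H, relGramInvTrace H M ∂(gaussianMatrix 𝕂 r n) =
      r + ENNReal.ofReal ((n : ℝ) - l) * ENNReal.ofReal (r / ((l : ℝ) - r - alpha 𝕂)) := by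
    have hset : MeasurableSet {M : Matrix (Fin n) (Fin l) 𝕂 | Mᴴ * M = 1} := by
      have hm : Measurable fun M : Matrix (Fin n) (Fin l) 𝕂 => Mᴴ * M :=
        Measurable.matrix_mul (Measurable.matrix_conjTranspose measurable_id) measurable_id
      have : {M : Matrix (Fin n) (Fin l) 𝕂 | Mᴴ * M = 1} =
          ⋂ i, ⋂ j, {M | (Mᴴ * M) i j = (1 : Matrix (Fin l) (Fin l) 𝕂) i j} := by
        ext M
        simp only [Set.mem_ofPred_eq, Set.mem_iInter, ← Matrix.ext_iff]
      rw [this]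
      exact MeasurableSet.iInter fun i => MeasurableSet.iInter fun j =>
        measurable_matrix_iff.mp hm i j (measurableSet_singleton _)
    filter_upwards [(ae_map_iff hae hset).mpr hΩ.orthonormal] with M hM
    exact lintegral_relGramInvTrace_gaussianMatrix h hM hln
  rw [lintegral_congr_ae key]
  simp

/-! ### The sketching error -/

/-- The error `(Qᴴ M)⁺ᴴ Mᴴ C` of the sketched problem, in the coordinates of the range of `Q`. -/
noncomputable def sketchError {𝕂 : Type*} [RCLike 𝕂] {n l r p : ℕ}
    (Q : Matrix (Fin n) (Fin r) 𝕂) (C : Matrix (Fin n) (Fin p) 𝕂)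
    (M : Matrix (Fin n) (Fin l) 𝕂) : Matrix (Fin r) (Fin p) 𝕂 :=
  (Qᴴ * M * (Qᴴ * M)ᴴ)⁻¹ * (Qᴴ * M) * Mᴴ * C

theorem measurable_sketchError {𝕂 : Type*} [RCLike 𝕂] {n l r p : ℕ}
    (Q : Matrix (Fin n) (Fin r) 𝕂) (C : Matrix (Fin n) (Fin p) 𝕂) :
    Measurable fun M : Matrix (Fin n) (Fin l) 𝕂 => sketchError Q C M := by
  have h : Measurable fun M : Matrix (Fin n) (Fin l) 𝕂 => Qᴴ * M :=
    Measurable.matrix_mul measurable_const measurable_id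
  exact Measurable.matrix_mul (Measurable.matrix_mul (measurable_rowPinv.comp h)
    (Measurable.matrix_conjTranspose measurable_id)) measurable_const

theorem measurable_normSq_sketchError {𝕂 : Type*} [RCLike 𝕂] {n l r p : ℕ}
    (Q : Matrix (Fin n) (Fin r) 𝕂) (C : Matrix (Fin n) (Fin p) 𝕂) :
    Measurable fun M : Matrix (Fin n) (Fin l) 𝕂 => ENNReal.ofReal (‖sketchError Q C M‖ ^ 2) :=
  (Measurable.frobenius_normSq (measurable_sketchError Q C)).ennreal_ofReal

/-- Rotating the sketch amounts to rotating the data, which turns invariance in law into symmetry in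
`(Q, C)`. -/
theorem sketchError_conjTranspose_mul {𝕂 : Type*} [RCLike 𝕂] {n l r p : ℕ}
    (Q : Matrix (Fin n) (Fin r) 𝕂) (C : Matrix (Fin n) (Fin p) 𝕂)
    (U : Matrix (Fin n) (Fin n) 𝕂) (M : Matrix (Fin n) (Fin l) 𝕂) :
    sketchError Q C (Uᴴ * M) = sketchError (U * Q) (U * C) M := by
  simp only [sketchError, conjTranspose_mul, conjTranspose_conjTranspose, Matrix.mul_assoc]

theorem normSq_sketchError_eq_sum_col {𝕂 : Type*} [RCLike 𝕂] {n l r p : ℕ}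
    (Q : Matrix (Fin n) (Fin r) 𝕂) (C : Matrix (Fin n) (Fin p) 𝕂)
    (M : Matrix (Fin n) (Fin l) 𝕂) :
    ENNReal.ofReal (‖sketchError Q C M‖ ^ 2) =
      ∑ j, ENNReal.ofReal (‖sketchError Q (C.submatrix id fun _ : Fin 1 => j) M‖ ^ 2) := by
  rw [← ENNReal.ofReal_sum_of_nonneg fun _ _ => by positivity]
  congr 1
  simp only [sketchError, frobenius_normSq, Fintype.sum_prod_type]
  rw [Finset.sum_comm]
  simp [mul_apply]

/-- The expected squared sketching error of a Gaussian matrix. -/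
theorem IsGaussian.lintegral_normSq_sketchError {𝕂 : Type*} [RCLike 𝕂] {S : Type*}
    [MeasurableSpace S] {μ : Measure S} [IsProbabilityMeasure μ] {n l r p : ℕ}
    {Ω : S → Matrix (Fin n) (Fin l) 𝕂} (hΩ : IsGaussian Ω μ) (hrn : r ≤ n)
    (h : r + alpha 𝕂 < l) {Q : Matrix (Fin n) (Fin r) 𝕂} (hQ : Qᴴ * Q = 1)
    {C : Matrix (Fin n) (Fin p) 𝕂} (hC : Qᴴ * C = 0) :
    ∫⁻ ω, ENNReal.ofReal (‖sketchError Q C (Ω ω)‖ ^ 2) ∂μ =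
      ENNReal.ofReal (r / ((l : ℝ) - r - alpha 𝕂) * ‖C‖ ^ 2) := by
  obtain ⟨k, hk⟩ := Nat.exists_eq_add_of_le hrn
  obtain ⟨Q', hQ', hQQ', hsum⟩ := exists_orthogonal_complement (k := k) (by simp [hk]) Q hQ
  have hCC : Q' * (Q'ᴴ * C) = C := by
    conv_rhs => rw [← Matrix.one_mul C, ← hsum, Matrix.add_mul, Matrix.mul_assoc, hC]
    simp [Matrix.mul_assoc]
  have hf : Measurable fun x : Matrix (Fin r) (Fin l) 𝕂 × Matrix (Fin k) (Fin l) 𝕂 =>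
      Q * x.1 + Q' * x.2 :=
    Measurable.matrix_add (Measurable.matrix_mul measurable_const measurable_fst)
      (Measurable.matrix_mul measurable_const measurable_snd)
  have hm := measurable_normSq_sketchError (l := l) Q C
  have h1 := lintegral_map (μ := (gaussianMatrix 𝕂 r l).prod (gaussianMatrix 𝕂 k l)) hm hf
  rw [gaussianMatrix_prod_map_mul_left hsum, ← hΩ.map_eq,
    lintegral_map' hm.aemeasurable hΩ.aemeasurable] at h1
  refine (h1.trans (lintegral_prod _ (hm.comp hf).aemeasurable)).trans ?_
  -- For fixed `N`, the adjoint of the error is `(Q'ᴴ C)ᴴ W ((N Nᴴ)⁻¹ N)ᴴ`, linear in the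
  -- independent Gaussian `W`.
  have key : ∀ᵐ N ∂(gaussianMatrix 𝕂 r l),
      ∫⁻ W, ENNReal.ofReal (‖sketchError Q C (Q * N + Q' * W)‖ ^ 2) ∂(gaussianMatrix 𝕂 k l) =
        ENNReal.ofReal (‖C‖ ^ 2) * gramInvTrace N := by
    filter_upwards [ae_gram_det_ne_zero_gaussianMatrix h] with N hN
    have e : ∀ W : Matrix (Fin k) (Fin l) 𝕂, ‖sketchError Q C (Q * N + Q' * W)‖ ^ 2 =
        ‖(Q'ᴴ * C)ᴴ * W * ((N * Nᴴ)⁻¹ * N)ᴴ‖ ^ 2 := by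
      intro W
      have e1 : Qᴴ * (Q * N + Q' * W) = N := by
        rw [Matrix.mul_add, ← Matrix.mul_assoc, ← Matrix.mul_assoc, hQ, hQQ']
        simp
      have e2 : (Q * N + Q' * W)ᴴ * C = Wᴴ * (Q'ᴴ * C) := by
        rw [conjTranspose_add, conjTranspose_mul, conjTranspose_mul, Matrix.add_mul,
          Matrix.mul_assoc, hC, Matrix.mul_assoc]
        simp
      rw [sketchError, e1, Matrix.mul_assoc _ (Q * N + Q' * W)ᴴ, e2,
        ← frobenius_norm_conjTranspose, conjTranspose_mul, conjTranspose_mul Wᴴ,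
        conjTranspose_conjTranspose]
    simp only [e]
    rw [lintegral_normSq_mul_mul_gaussianMatrix, gramInvTrace, if_neg hN,
      frobenius_norm_conjTranspose, frobenius_norm_conjTranspose, ← normSq_isometry_mul hQ', hCC,
      ENNReal.ofReal_mul (by positivity)]
  have h2 := lintegral_congr_ae key
  rw [lintegral_const_mul _ measurable_gramInvTrace, lintegral_gramInvTrace_gaussianMatrix h] at h2
  rw [mul_comm, ENNReal.ofReal_mul (by positivity), ← h2]

/-- `[Q q]` and `[Q q']` are isometries of the same shape, so some unitary fixes `Q` and sends `q`
to `q'`. The condition `r < n` leaves room for the extra column. -/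
theorem IsRotationInvariant.lintegral_normSq_sketchError_eq {𝕂 : Type*} [RCLike 𝕂] {S : Type*}
    [MeasurableSpace S] {μ : Measure S} {n l r : ℕ} {Ω : S → Matrix (Fin n) (Fin l) 𝕂}
    (h : IsRotationInvariant Ω μ) (hrn : r < n) {Q : Matrix (Fin n) (Fin r) 𝕂}
    (hQ : Qᴴ * Q = 1) {q q' : Matrix (Fin n) (Fin 1) 𝕂} (hq : qᴴ * q = 1) (hQq : Qᴴ * q = 0)
    (hq' : q'ᴴ * q' = 1) (hQq' : Qᴴ * q' = 0) :
    ∫⁻ ω, ENNReal.ofReal (‖sketchError Q q' (Ω ω)‖ ^ 2) ∂μ =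
      ∫⁻ ω, ENNReal.ofReal (‖sketchError Q q (Ω ω)‖ ^ 2) ∂μ := by
  have iso : ∀ {v : Matrix (Fin n) (Fin 1) 𝕂}, vᴴ * v = 1 → Qᴴ * v = 0 →
      (fromCols Q v)ᴴ * fromCols Q v = 1 := by
    intro v hv hQv
    have hvQ : vᴴ * Q = 0 := by
      rw [← conjTranspose_conjTranspose Q, ← conjTranspose_mul, hQv, conjTranspose_zero]
    rw [conjTranspose_fromCols_eq_fromRows_conjTranspose, fromRows_mul_fromCols, hQ, hv, hQv, hvQ,
      fromBlocks_one]
  obtain ⟨U, hU, hUQ⟩ := exists_unitary_mul_eq (by simpa using hrn) (iso hq hQq) (iso hq' hQq')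
  rw [mul_fromCols, fromCols_ext_iff] at hUQ
  have h1 := h.lintegral_eq hU (measurable_normSq_sketchError (l := l) Q q)
  simp only [sketchError_conjTranspose_mul, hUQ.1, hUQ.2] at h1
  exact h1

/-- Put `X = (N Nᴴ)⁻¹ N` with `N = Qᴴ M`. Since `Mᴴ M = 1`, `X` and `X Mᴴ` have the same norm; in
the basis `[Q Q']` the coefficients of `X Mᴴ` are the identity, of squared norm `r`, and the
sketching error for `Q'`. -/
theorem normSq_sketchError_isometry_add {𝕂 : Type*} [RCLike 𝕂] {n l r k : ℕ}
    {Q : Matrix (Fin n) (Fin r) 𝕂} {Q' : Matrix (Fin n) (Fin k) 𝕂}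
    (hsum : Q * Qᴴ + Q' * Q'ᴴ = 1) (hQ : Qᴴ * Q = 1) (hQ' : Q'ᴴ * Q' = 1) (hQQ' : Qᴴ * Q' = 0)
    {M : Matrix (Fin n) (Fin l) 𝕂} (hM : Mᴴ * M = 1) (hdet : (Qᴴ * M * (Qᴴ * M)ᴴ).det ≠ 0) :
    ENNReal.ofReal (‖sketchError Q Q' M‖ ^ 2) + r = gramInvTrace (Qᴴ * M) := by
  rw [gramInvTrace, if_neg hdet, ← ENNReal.ofReal_natCast,
    ← ENNReal.ofReal_add (by positivity) (by positivity)]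
  congr 1
  set X := (Qᴴ * M * (Qᴴ * M)ᴴ)⁻¹ * (Qᴴ * M) with hX
  have h1 : X * Mᴴ * Q = 1 := by
    rw [Matrix.mul_assoc, show Mᴴ * Q = (Qᴴ * M)ᴴ by simp, hX,
      rowPinv_mul_conjTranspose_self hdet]
  have h2 : X * Mᴴ = X * Mᴴ * Q * Qᴴ + X * Mᴴ * Q' * Q'ᴴ := by
    rw [Matrix.mul_assoc _ Q, Matrix.mul_assoc _ Q', ← Matrix.mul_add, hsum, Matrix.mul_one]
  rw [← normSq_mul_isometry_conjTranspose hM X, h2,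
    normSq_mul_isometry_conjTranspose_add hQ hQ' hQQ', h1, normSq_one, add_comm]
  rfl

theorem IsRandomOrthonormal.ae_gram_det_ne_zero {𝕂 : Type*} [RCLike 𝕂] {S : Type*}
    [MeasurableSpace S] {μ : Measure S} [IsProbabilityMeasure μ] {n l r : ℕ}
    {Ω : S → Matrix (Fin n) (Fin l) 𝕂} (hΩ : IsRandomOrthonormal Ω μ) (hln : l ≤ n)
    (h : r + alpha 𝕂 < l) {Q : Matrix (Fin n) (Fin r) 𝕂} (hQ : Qᴴ * Q = 1) :
    ∀ᵐ ω ∂μ, (Qᴴ * Ω ω * (Qᴴ * Ω ω)ᴴ).det ≠ 0 := by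
  have hm : Measurable fun M : Matrix (Fin n) (Fin l) 𝕂 => gramInvTrace (Qᴴ * M) :=
    measurable_gramInvTrace.comp (Measurable.matrix_mul measurable_const measurable_id)
  have h2 := ae_lt_top' (hm.comp_aemeasurable hΩ.rotationInvariant.aemeasurable)
    (by
      have h3 := hΩ.lintegral_gramInvTrace hln h hQ
      simp only [Function.comp_def, h3]
      finiteness)
  filter_upwards [h2] with ω hω hd
  rw [Function.comp_apply, gramInvTrace, if_pos hd] at hω
  exact lt_irrefl _ hω

theorem IsGaussian.ae_gram_det_ne_zero {𝕂 : Type*} [RCLike 𝕂] {S : Type*}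
    [MeasurableSpace S] {μ : Measure S} [IsProbabilityMeasure μ] {n l r : ℕ}
    {Ω : S → Matrix (Fin n) (Fin l) 𝕂} (hΩ : IsGaussian Ω μ)
    (h : r + alpha 𝕂 < l) {Q : Matrix (Fin n) (Fin r) 𝕂} (hQ : Qᴴ * Q = 1) :
    ∀ᵐ ω ∂μ, (Qᴴ * Ω ω * (Qᴴ * Ω ω)ᴴ).det ≠ 0 := by
  have hm : Measurable fun M : Matrix (Fin n) (Fin l) 𝕂 => Qᴴ * M :=
    Measurable.matrix_mul measurable_const measurable_id
  have h1 := ae_gram_det_ne_zero_gaussianMatrix h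
  rw [← gaussianMatrix_map_mul_left (U := Qᴴ) (k := l) (by simpa using hQ), ← hΩ.map_eq] at h1
  exact ae_of_ae_map hΩ.aemeasurable (ae_of_ae_map hm.aemeasurable h1)

/-- The expected squared sketching error of a random orthonormal matrix. -/
theorem IsRandomOrthonormal.lintegral_normSq_sketchError {𝕂 : Type*} [RCLike 𝕂] {S : Type*}
    [MeasurableSpace S] {μ : Measure S} [IsProbabilityMeasure μ] {n l r p : ℕ}
    {Ω : S → Matrix (Fin n) (Fin l) 𝕂} (hΩ : IsRandomOrthonormal Ω μ) (hln : l ≤ n)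
    (h : r + alpha 𝕂 < l) {Q : Matrix (Fin n) (Fin r) 𝕂} (hQ : Qᴴ * Q = 1)
    {C : Matrix (Fin n) (Fin p) 𝕂} (hC : Qᴴ * C = 0) :
    ∫⁻ ω, ENNReal.ofReal (‖sketchError Q C (Ω ω)‖ ^ 2) ∂μ =
      ENNReal.ofReal (((n : ℝ) - l) / ((n : ℝ) - r) * (r / ((l : ℝ) - r - alpha 𝕂)) *
        ‖C‖ ^ 2) := by
  have hrn : r < n := by omega
  have hae := hΩ.rotationInvariant.aemeasurable
  have hmeas : ∀ {p : ℕ} (C : Matrix (Fin n) (Fin p) 𝕂),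
      AEMeasurable (fun ω => ENNReal.ofReal (‖sketchError Q C (Ω ω)‖ ^ 2)) μ := fun C =>
    (measurable_normSq_sketchError Q C).comp_aemeasurable hae
  obtain ⟨k, hk⟩ := Nat.exists_eq_add_of_le hrn.le
  have hk0 : 0 < k := by omega
  obtain ⟨Q', hQ', hQQ', hsum⟩ := exists_orthogonal_complement (k := k) (by simp [hk]) Q hQ
  have hcol : ∀ j,
      (Q'.submatrix id fun _ : Fin 1 => j)ᴴ * (Q'.submatrix id fun _ : Fin 1 => j) = 1 ∧
      Qᴴ * (Q'.submatrix id fun _ : Fin 1 => j) = 0 := by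
    intro j
    constructor
    · ext a b
      have := congrFun (congrFun hQ' j) j
      rw [Subsingleton.elim a 0, Subsingleton.elim b 0]
      simpa [mul_apply] using this
    · ext a b
      have := congrFun (congrFun hQQ' a) j
      simpa [mul_apply] using this
  set κ : ℝ := ((n : ℝ) - l) / ((n : ℝ) - r) * (r / ((l : ℝ) - r - alpha 𝕂)) with hκ
  have hnr : (n : ℝ) - r = k := by rw [hk]; push_cast; ring
  have hl0 : (0 : ℝ) < (l : ℝ) - r - alpha 𝕂 := by
    have : (r : ℝ) + alpha 𝕂 < l := by exact_mod_cast h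
    linarith
  have hnl : (0 : ℝ) ≤ (n : ℝ) - l := sub_nonneg.mpr (by exact_mod_cast hln)
  have hκ0 : 0 ≤ κ := by
    rw [hκ, hnr]
    positivity
  -- The total over the `k = n - r` columns of `Q'` is known and all columns have equal mean, so
  -- each unit direction gets the total divided by `k`.
  have hunit : ∀ q : Matrix (Fin n) (Fin 1) 𝕂, qᴴ * q = 1 → Qᴴ * q = 0 →
      ∫⁻ ω, ENNReal.ofReal (‖sketchError Q q (Ω ω)‖ ^ 2) ∂μ = ENNReal.ofReal κ := by
    intro q hq hQq
    set I := ∫⁻ ω, ENNReal.ofReal (‖sketchError Q q (Ω ω)‖ ^ 2) ∂μ with hI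
    have h1 : ∫⁻ ω, ENNReal.ofReal (‖sketchError Q Q' (Ω ω)‖ ^ 2) ∂μ = k * I := by
      simp only [normSq_sketchError_eq_sum_col Q Q']
      rw [lintegral_finsetSum' _ fun j _ => hmeas _]
      simp only [fun j => hΩ.rotationInvariant.lintegral_normSq_sketchError_eq hrn hQ hq hQq
        (hcol j).1 (hcol j).2]
      simp [hI]
    have h2 : k * I + r =
        r + ENNReal.ofReal ((n : ℝ) - l) * ENNReal.ofReal (r / ((l : ℝ) - r - alpha 𝕂)) := by
      rw [← h1, ← hΩ.lintegral_gramInvTrace hln h hQ]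
      have h3 : ∫⁻ ω, gramInvTrace (Qᴴ * Ω ω) ∂μ =
          ∫⁻ ω, (ENNReal.ofReal (‖sketchError Q Q' (Ω ω)‖ ^ 2) + r) ∂μ := by
        refine lintegral_congr_ae ?_
        filter_upwards [hΩ.orthonormal, hΩ.ae_gram_det_ne_zero hln h hQ] with ω hω hd
        exact (normSq_sketchError_isometry_add hsum hQ hQ' hQQ' hω hd).symm
      rw [h3, lintegral_add_right _ measurable_const]
      simp
    rw [add_comm, ENNReal.add_right_inj (ENNReal.natCast_ne_top r),
      ← ENNReal.ofReal_mul hnl] at h2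
    have h4 : (k : ENNReal) * ENNReal.ofReal κ =
        ENNReal.ofReal (((n : ℝ) - l) * (r / ((l : ℝ) - r - alpha 𝕂))) := by
      rw [← ENNReal.ofReal_natCast, ← ENNReal.ofReal_mul (by positivity), hκ, hnr]
      congr 1
      field_simp
    rw [← h4] at h2
    exact (ENNReal.mul_right_inj (by exact_mod_cast hk0.ne') (ENNReal.natCast_ne_top k)).mp h2
  -- The error is linear in `c`; normalising a nonzero column reduces to the unit case.
  have hcolC : ∀ c : Matrix (Fin n) (Fin 1) 𝕂, Qᴴ * c = 0 →
      ∫⁻ ω, ENNReal.ofReal (‖sketchError Q c (Ω ω)‖ ^ 2) ∂μ = ENNReal.ofReal (κ * ‖c‖ ^ 2) := by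
    intro c hc
    by_cases hc0 : c = 0
    · simp [hc0, sketchError]
    have hcn : ‖c‖ ≠ 0 := norm_ne_zero_iff.mpr hc0
    have hcc : cᴴ * c = ((‖c‖ ^ 2 : ℝ) : 𝕂) • (1 : Matrix (Fin 1) (Fin 1) 𝕂) := by
      ext a b
      rw [Subsingleton.elim a 0, Subsingleton.elim b 0, frobenius_normSq, mul_apply]
      simp [conjTranspose_apply, RCLike.conj_mul, Fintype.sum_prod_type]
    set q : Matrix (Fin n) (Fin 1) 𝕂 := ((‖c‖⁻¹ : ℝ) : 𝕂) • c with hq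
    have hqc : c = ((‖c‖ : ℝ) : 𝕂) • q := by
      rw [hq, smul_smul, ← RCLike.ofReal_mul, mul_inv_cancel₀ hcn]
      simp
    have hqq : qᴴ * q = 1 := by
      rw [hq, conjTranspose_smul, Matrix.smul_mul, Matrix.mul_smul, hcc, smul_smul, smul_smul,
        RCLike.star_def, RCLike.conj_ofReal, ← RCLike.ofReal_mul, ← RCLike.ofReal_mul]
      rw [show ‖c‖⁻¹ * ‖c‖⁻¹ * ‖c‖ ^ 2 = 1 by field_simp]
      simp
    have hQq : Qᴴ * q = 0 := by rw [hq, Matrix.mul_smul, hc, smul_zero]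
    have e : ∀ ω, ENNReal.ofReal (‖sketchError Q c (Ω ω)‖ ^ 2) =
        ENNReal.ofReal (‖c‖ ^ 2) * ENNReal.ofReal (‖sketchError Q q (Ω ω)‖ ^ 2) := by
      intro ω
      have e1 : sketchError Q c (Ω ω) = ((‖c‖ : ℝ) : 𝕂) • sketchError Q q (Ω ω) := by
        conv_lhs => rw [sketchError, hqc, Matrix.mul_smul]
        rfl
      rw [← ENNReal.ofReal_mul (by positivity), e1]
      congr 1
      simp only [frobenius_normSq (_ • _), Matrix.smul_apply, norm_smul, mul_pow,
        ← Finset.mul_sum, RCLike.norm_ofReal, abs_norm]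
      rw [← frobenius_normSq (sketchError Q q (Ω ω))]
    simp only [e]
    rw [lintegral_const_mul'' _ (hmeas q), hunit q hqq hQq, ← ENNReal.ofReal_mul (by positivity),
      mul_comm]
  simp only [normSq_sketchError_eq_sum_col Q C]
  rw [lintegral_finsetSum' _ fun j _ => hmeas _]
  have hCj : ∀ j, Qᴴ * (C.submatrix id fun _ : Fin 1 => j) = 0 := by
    intro j
    ext a b
    have := congrFun (congrFun hC a) j
    simpa [mul_apply] using this
  simp only [fun j => hcolC _ (hCj j)]
  rw [← ENNReal.ofReal_sum_of_nonneg fun _ _ => by positivity, ← Finset.mul_sum]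
  congr 2
  simp only [frobenius_normSq, Fintype.sum_prod_type]
  rw [Finset.sum_comm]
  simp

/-! ### Sketch-and-solve -/

/-- The part `Q Qᴴ B` of the data lies in the range of `Q`, and `(Ωᴴ Q)⁺ Ωᴴ Q = 1` makes the sketch
recover it exactly; only the orthogonal part leaves an error. -/
theorem sketchSolve_eq {𝕂 : Type*} [RCLike 𝕂] {n l r d p : ℕ} {Q : Matrix (Fin n) (Fin r) 𝕂}
    {T : Matrix (Fin r) (Fin d) 𝕂} (hQ : Qᴴ * Q = 1) (hT : IsUnit (T * Tᴴ).det)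
    (B : Matrix (Fin n) (Fin p) 𝕂) {M : Matrix (Fin n) (Fin l) 𝕂}
    (hdet : (Qᴴ * M * (Qᴴ * M)ᴴ).det ≠ 0) :
    sketchSolve M (Q * T) B =
      pinv (Q * T) * B + Tᴴ * (T * Tᴴ)⁻¹ * sketchError Q (B - Q * (Qᴴ * B)) M := by
  have hN : (Qᴴ * M)ᴴ = Mᴴ * Q := by simp
  have hF : ((Mᴴ * Q)ᴴ * (Mᴴ * Q)) = Qᴴ * M * (Qᴴ * M)ᴴ := by
    rw [← hN, conjTranspose_conjTranspose]
  have hN1 : (Qᴴ * M * (Qᴴ * M)ᴴ)⁻¹ * (Qᴴ * M) * Mᴴ * Q = 1 := by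
    rw [Matrix.mul_assoc _ Mᴴ, ← hN, rowPinv_mul_conjTranspose_self hdet]
  rw [sketchSolve, ← Matrix.mul_assoc, ← Matrix.mul_assoc Mᴴ Q T,
    pinv_mul_eq (F := Mᴴ * Q) (by rw [hF]; exact isUnit_iff_ne_zero.mpr hdet)
    hT, pinv_mul_eq (by rw [hQ]; simp) hT, hF, hQ, inv_one, Matrix.one_mul, ← hN,
    conjTranspose_conjTranspose, sketchError, Matrix.mul_sub, ← Matrix.mul_assoc _ Q, hN1,
    Matrix.one_mul, Matrix.mul_sub]
  simp only [Matrix.mul_assoc]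
  abel

/-- `T` cancels its right inverse, so the error appears inside the range of `Q`, orthogonal to the
optimal residual. -/
theorem sub_mul_sketchSolve_eq {𝕂 : Type*} [RCLike 𝕂] {n l r d p : ℕ}
    {Q : Matrix (Fin n) (Fin r) 𝕂} {T : Matrix (Fin r) (Fin d) 𝕂} (hQ : Qᴴ * Q = 1)
    (hT : IsUnit (T * Tᴴ).det) (B : Matrix (Fin n) (Fin p) 𝕂) {M : Matrix (Fin n) (Fin l) 𝕂}
    (hdet : (Qᴴ * M * (Qᴴ * M)ᴴ).det ≠ 0) :
    B - Q * T * sketchSolve M (Q * T) B =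
      (B - Q * (Qᴴ * B)) + Q * -sketchError Q (B - Q * (Qᴴ * B)) M := by
  have hT1 : T * (Tᴴ * (T * Tᴴ)⁻¹) = 1 := by rw [← Matrix.mul_assoc, mul_nonsing_inv _ hT]
  have hp : Q * T * (pinv (Q * T) * B) = Q * (Qᴴ * B) := by
    rw [pinv_mul_eq (by rw [hQ]; simp) hT, hQ, inv_one, Matrix.one_mul, Matrix.mul_assoc Q,
      ← Matrix.mul_assoc T, ← Matrix.mul_assoc T, hT1, Matrix.one_mul]
  rw [sketchSolve_eq hQ hT B hdet, Matrix.mul_add, hp, Matrix.mul_assoc Q,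
    ← Matrix.mul_assoc T, hT1, Matrix.one_mul, Matrix.mul_neg]
  abel

theorem conjTranspose_mul_sub_projection {𝕂 : Type*} [RCLike 𝕂] {n r p : ℕ}
    {Q : Matrix (Fin n) (Fin r) 𝕂} (hQ : Qᴴ * Q = 1) (B : Matrix (Fin n) (Fin p) 𝕂) :
    Qᴴ * (B - Q * (Qᴴ * B)) = 0 := by
  rw [Matrix.mul_sub, ← Matrix.mul_assoc, hQ, Matrix.one_mul, sub_self]

theorem normSq_add_isometry_mul {𝕂 : Type*} [RCLike 𝕂] {n r p : ℕ}
    {Q : Matrix (Fin n) (Fin r) 𝕂} (hQ : Qᴴ * Q = 1) {C : Matrix (Fin n) (Fin p) 𝕂}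
    (hC : Qᴴ * C = 0) (Y : Matrix (Fin r) (Fin p) 𝕂) :
    ‖C + Q * Y‖ ^ 2 = ‖C‖ ^ 2 + ‖Y‖ ^ 2 := by
  have hC' : Cᴴ * Q = 0 := by
    rw [← conjTranspose_conjTranspose Q, ← conjTranspose_mul, hC, conjTranspose_zero]
  rw [normSq_add_of_conjTranspose_mul_eq_zero, normSq_isometry_mul hQ]
  rw [← Matrix.mul_assoc, hC', Matrix.zero_mul]

theorem isLeast_normSq_residual {𝕂 : Type*} [RCLike 𝕂] {n r d p : ℕ}
    {Q : Matrix (Fin n) (Fin r) 𝕂} {T : Matrix (Fin r) (Fin d) 𝕂} (hQ : Qᴴ * Q = 1)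
    (hT : IsUnit (T * Tᴴ).det) (B : Matrix (Fin n) (Fin p) 𝕂) :
    IsLeast (Set.range fun X : Matrix (Fin d) (Fin p) 𝕂 => ‖B - Q * T * X‖ ^ 2)
      (‖B - Q * (Qᴴ * B)‖ ^ 2) := by
  constructor
  · refine ⟨Tᴴ * (T * Tᴴ)⁻¹ * (Qᴴ * B), ?_⟩
    have hT1 : T * (Tᴴ * (T * Tᴴ)⁻¹) = 1 := by rw [← Matrix.mul_assoc, mul_nonsing_inv _ hT]
    simp only
    rw [Matrix.mul_assoc Q, ← Matrix.mul_assoc T, hT1, Matrix.one_mul]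
  · rintro _ ⟨X, rfl⟩
    have e : B - Q * T * X = (B - Q * (Qᴴ * B)) + Q * (Qᴴ * B - T * X) := by
      rw [Matrix.mul_sub, Matrix.mul_assoc]
      abel
    simp only [e]
    rw [normSq_add_isometry_mul hQ (conjTranspose_mul_sub_projection hQ B)]
    have := sq_nonneg ‖Qᴴ * B - T * X‖
    linarith

theorem integrable_normSq_of_lintegral_eq {𝕂 : Type*} [RCLike 𝕂] {S : Type*}
    [MeasurableSpace S] {μ : Measure S} {r p : ℕ} {Y : S → Matrix (Fin r) (Fin p) 𝕂}
    (hY : AEMeasurable Y μ) {s : ℝ} (hs : 0 ≤ s)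
    (h : ∫⁻ ω, ENNReal.ofReal (‖Y ω‖ ^ 2) ∂μ = ENNReal.ofReal s) :
    Integrable (fun ω => ‖Y ω‖ ^ 2) μ ∧ ∫ ω, ‖Y ω‖ ^ 2 ∂μ = s := by
  have hm : AEMeasurable (fun ω => ‖Y ω‖ ^ 2) μ :=
    (Measurable.frobenius_normSq measurable_id).comp_aemeasurable hY
  constructor
  · refine (lintegral_ofReal_ne_top_iff_integrable hm.aestronglyMeasurable
      (Filter.Eventually.of_forall fun ω => sq_nonneg _)).mp ?_
    rw [h]
    exact ENNReal.ofReal_ne_top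
  · rw [integral_eq_lintegral_of_nonneg_ae (Filter.Eventually.of_forall fun ω => sq_nonneg _)
      hm.aestronglyMeasurable, h, ENNReal.toReal_ofReal hs]

theorem integrable_apply_of_integrable_normSq {𝕂 : Type*} [RCLike 𝕂] {S : Type*}
    [MeasurableSpace S] {μ : Measure S} [IsFiniteMeasure μ] {r p : ℕ}
    {Y : S → Matrix (Fin r) (Fin p) 𝕂} (hY : AEMeasurable Y μ)
    (h : Integrable (fun ω => ‖Y ω‖ ^ 2) μ) (i : Fin r) (j : Fin p) :
    Integrable (fun ω => Y ω i j) μ := by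
  have hm : AEMeasurable (fun ω => Y ω i j) μ := (measurable_matrix_apply i j).comp_aemeasurable hY
  refine (h.add (integrable_const 1)).mono' hm.aestronglyMeasurable
    (Filter.Eventually.of_forall fun ω => ?_)
  have h1 : ‖Y ω i j‖ ^ 2 ≤ ‖Y ω‖ ^ 2 := by
    rw [frobenius_normSq]
    exact Finset.single_le_sum (f := fun x : Fin r × Fin p => ‖Y ω x.1 x.2‖ ^ 2)
      (fun x _ => by positivity) (Finset.mem_univ (i, j))
  simp only [Pi.add_apply]
  -- The bound is `|y| ≤ |y|² + 1`, integrable because the measure is finite.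
  nlinarith [sq_nonneg (‖Y ω i j‖ - 1)]

/-- The sketching error of a rotation-invariant embedding is centred. -/
theorem IsRotationInvariant.integral_sketchError_eq_zero {𝕂 : Type*} [RCLike 𝕂] {S : Type*}
    [MeasurableSpace S] {μ : Measure S} {n l r p : ℕ} {Ω : S → Matrix (Fin n) (Fin l) 𝕂}
    (h : IsRotationInvariant Ω μ) {Q : Matrix (Fin n) (Fin r) 𝕂} (hQ : Qᴴ * Q = 1)
    {C : Matrix (Fin n) (Fin p) 𝕂} (hC : Qᴴ * C = 0) (i : Fin r) (j : Fin p) :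
    ∫ ω, sketchError Q C (Ω ω) i j ∂μ = 0 := by
  -- The reflection across the range of `Q`: it fixes `Q` and negates everything orthogonal to it.
  set U : Matrix (Fin n) (Fin n) 𝕂 := Q * Qᴴ + Q * Qᴴ - 1 with hU
  have hUH : Uᴴ = U := by simp [hU]
  have hPP : Q * Qᴴ * (Q * Qᴴ) = Q * Qᴴ := by
    rw [Matrix.mul_assoc, ← Matrix.mul_assoc Qᴴ, hQ, Matrix.one_mul]
  have hUU : U ∈ Matrix.unitaryGroup (Fin n) 𝕂 := by
    rw [mem_unitaryGroup_iff, star_eq_conjTranspose, hUH, hU]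
    simp only [Matrix.sub_mul, Matrix.mul_sub, Matrix.add_mul, Matrix.mul_add, hPP,
      Matrix.one_mul, Matrix.mul_one]
    abel
  have hUQ : U * Q = Q := by
    rw [hU, Matrix.sub_mul, Matrix.add_mul, Matrix.mul_assoc, hQ, Matrix.mul_one, Matrix.one_mul]
    abel
  have hUC : U * C = -C := by
    rw [hU, Matrix.sub_mul, Matrix.add_mul, Matrix.mul_assoc, hC, Matrix.mul_zero, Matrix.one_mul]
    simp
  have hm : Measurable fun M : Matrix (Fin n) (Fin l) 𝕂 => sketchError Q C M i j :=
    measurable_matrix_iff.mp (measurable_sketchError Q C) i j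
  have hid := ((h U hUU).comp hm).integral_eq
  have e : ∀ ω, sketchError Q C (U * Ω ω) i j = -sketchError Q C (Ω ω) i j := by
    intro ω
    conv_lhs => rw [← hUH, sketchError_conjTranspose_mul, hUQ, hUC]
    simp [sketchError]
  simp only [Function.comp_def, e, integral_neg] at hid
  exact self_eq_neg.mp hid.symm

/-- The part common to both embeddings: the particular law enters only through almost sure full rank
and the constant `κ` in the second moment of the error. -/
theorem IsRotationInvariant.sketchSolve_analysis {𝕂 : Type*} [RCLike 𝕂] {S : Type*}
    [MeasurableSpace S] {μ : Measure S} [IsProbabilityMeasure μ] {n l r d p : ℕ}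
    {Ω : S → Matrix (Fin n) (Fin l) 𝕂} (h : IsRotationInvariant Ω μ)
    {Q : Matrix (Fin n) (Fin r) 𝕂} {T : Matrix (Fin r) (Fin d) 𝕂} (hQ : Qᴴ * Q = 1)
    (hT : IsUnit (T * Tᴴ).det) (B : Matrix (Fin n) (Fin p) 𝕂)
    (hdet : ∀ᵐ ω ∂μ, (Qᴴ * Ω ω * (Qᴴ * Ω ω)ᴴ).det ≠ 0) {κ : ℝ} (hκ : 0 ≤ κ)
    (herr : ∫⁻ ω, ENNReal.ofReal (‖sketchError Q (B - Q * (Qᴴ * B)) (Ω ω)‖ ^ 2) ∂μ =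
      ENNReal.ofReal (κ * ‖B - Q * (Qᴴ * B)‖ ^ 2)) :
    HasExpectation (fun ω => sketchSolve (Ω ω) (Q * T) B) μ (pinv (Q * T) * B) ∧
      Integrable (fun ω => ‖B - Q * T * sketchSolve (Ω ω) (Q * T) B‖ ^ 2) μ ∧
      ∫ ω, ‖B - Q * T * sketchSolve (Ω ω) (Q * T) B‖ ^ 2 ∂μ =
        (1 + κ) * ‖B - Q * (Qᴴ * B)‖ ^ 2 := by
  set C := B - Q * (Qᴴ * B) with hCdef
  have hC : Qᴴ * C = 0 := conjTranspose_mul_sub_projection hQ B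
  have hY : AEMeasurable (fun ω => sketchError Q C (Ω ω)) μ :=
    (measurable_sketchError Q C).comp_aemeasurable h.aemeasurable
  obtain ⟨hint, hval⟩ := integrable_normSq_of_lintegral_eq hY (by positivity) herr
  refine ⟨fun i j => ?_, ?_⟩
  · have hYint := fun a => integrable_apply_of_integrable_normSq hY hint a j
    have hae : (fun ω => sketchSolve (Ω ω) (Q * T) B i j) =ᵐ[μ] fun ω =>
        (pinv (Q * T) * B) i j +
          ∑ a, (Tᴴ * (T * Tᴴ)⁻¹) i a * sketchError Q C (Ω ω) a j := by
      filter_upwards [hdet] with ω hω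
      rw [sketchSolve_eq hQ hT B hω, Matrix.add_apply, mul_apply (N := sketchError _ _ _)]
    have hsum : Integrable (fun ω => ∑ a, (Tᴴ * (T * Tᴴ)⁻¹) i a * sketchError Q C (Ω ω) a j) μ :=
      integrable_finsetSum _ fun a _ => (hYint a).const_mul _
    refine ⟨((integrable_const _).add hsum).congr hae.symm, ?_⟩
    rw [integral_congr_ae hae, integral_add (integrable_const _) hsum,
      integral_finsetSum _ fun a _ => (hYint a).const_mul _]
    simp [integral_const_mul, h.integral_sketchError_eq_zero hQ hC]
  · have hae : (fun ω => ‖B - Q * T * sketchSolve (Ω ω) (Q * T) B‖ ^ 2) =ᵐ[μ] fun ω =>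
        ‖C‖ ^ 2 + ‖sketchError Q C (Ω ω)‖ ^ 2 := by
      filter_upwards [hdet] with ω hω
      rw [sub_mul_sketchSolve_eq hQ hT B hω, normSq_add_isometry_mul hQ hC, norm_neg]
    refine ⟨((integrable_const _).add hint).congr hae.symm, ?_⟩
    rw [integral_congr_ae hae, integral_add (integrable_const _) hint, hval]
    simp
    ring

end SketchSolve

/-! ### The main theorem -/

theorem theorem2p1 {𝕂 : Type*} [RCLike 𝕂] {S : Type*} [MeasurableSpace S]
    (μ : Measure S) [IsProbabilityMeasure μ] (n l d p : ℕ) (hln : l ≤ n)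
    (Ω : S → Matrix (Fin n) (Fin l) 𝕂)
    (A : Matrix (Fin n) (Fin d) 𝕂) (B : Matrix (Fin n) (Fin p) 𝕂)
    (hr : A.rank + SketchSolve.alpha 𝕂 < l) :
    (SketchSolve.IsGaussian Ω μ ∨ SketchSolve.IsRandomOrthonormal Ω μ →
      SketchSolve.HasExpectation (fun ω => SketchSolve.sketchSolve (Ω ω) A B) μ
        (SketchSolve.pinv A * B)) ∧
    ∃ R : ℝ, IsLeast (Set.range fun X : Matrix (Fin d) (Fin p) 𝕂 => ‖B - A * X‖ ^ 2) R ∧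
      (SketchSolve.IsGaussian Ω μ →
        Integrable (fun ω => ‖B - A * SketchSolve.sketchSolve (Ω ω) A B‖ ^ 2) μ ∧
        ∫ ω, ‖B - A * SketchSolve.sketchSolve (Ω ω) A B‖ ^ 2 ∂μ =
          (1 + (A.rank : ℝ) / ((l : ℝ) - A.rank - SketchSolve.alpha 𝕂)) * R) ∧
      (SketchSolve.IsRandomOrthonormal Ω μ →
        Integrable (fun ω => ‖B - A * SketchSolve.sketchSolve (Ω ω) A B‖ ^ 2) μ ∧
        ∫ ω, ‖B - A * SketchSolve.sketchSolve (Ω ω) A B‖ ^ 2 ∂μ =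
          (1 + ((n : ℝ) - l) / ((n : ℝ) - A.rank) *
            ((A.rank : ℝ) / ((l : ℝ) - A.rank - SketchSolve.alpha 𝕂))) * R) := by
  generalize hrk : A.rank = r at hr
  obtain ⟨Q, T, hQ, rfl, hT⟩ := SketchSolve.exists_isometry_mul A hrk
  have hl0 : (0 : ℝ) < (l : ℝ) - r - SketchSolve.alpha 𝕂 := by
    have : (r : ℝ) + SketchSolve.alpha 𝕂 < l := by exact_mod_cast hr
    linarith
  have hnl : (0 : ℝ) ≤ (n : ℝ) - l := sub_nonneg.mpr (by exact_mod_cast hln)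
  have hnr : (0 : ℝ) ≤ (n : ℝ) - r := sub_nonneg.mpr (by exact_mod_cast (by omega : r ≤ n))
  have hC := SketchSolve.conjTranspose_mul_sub_projection hQ B
  have hG := fun h : SketchSolve.IsGaussian Ω μ =>
    h.isRotationInvariant.sketchSolve_analysis hQ hT B (h.ae_gram_det_ne_zero hr hQ)
      (by positivity) (h.lintegral_normSq_sketchError (by omega) hr hQ hC)
  have hO := fun h : SketchSolve.IsRandomOrthonormal Ω μ =>
    h.rotationInvariant.sketchSolve_analysis hQ hT B (h.ae_gram_det_ne_zero hln hr hQ)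
      (by positivity) (h.lintegral_normSq_sketchError hln hr hQ hC)
  exact ⟨fun h => h.elim (fun h => (hG h).1) fun h => (hO h).1,
    _, SketchSolve.isLeast_normSq_residual hQ hT B, fun h => (hG h).2, fun h => (hO h).2⟩
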